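/- Let $r\ge 2$, $n\ge 1$, fix a sign $\epsilon\in\{\pm1\}$, and let $\mathbb F=\mathbb C(q,k)$. For $N\ge1$ let $\mathbb K^{(N)}=\mathbb F(g^{(N)}_j : 1\le j<N/2)$ be the field of rational functions in the independent variables $g_j^{(N)}$; extend to all $j\in\mathbb Z$ by $g^{(N)}_0=-1$, $g^{(N)}_{N/2}=\epsilon^{-1}k^{-1}$ ($N$ even), $g^{(N)}_j=k^{-2}(g^{(N)}_{N-j})^{-1}$ for $N/2<j<N$, and $N$-periodicity. Let $\epsilon_1,\dots,\epsilon_r$ be the standard basis of $\mathbb Z^r$ (scalar product $(\cdot,\cdot)$), $\alpha_i=\epsilon_i-\epsilon_{i+1}$ for $1\le i<r$, $\theta=\epsilon_1-\epsilon_r$, $\alpha_0=-\theta$, and let $s_{\alpha_j}$ be the corresponding reflections. For $c\in\mathbb Z$ put $x^{(\lambda,c)}=q^cx^\lambda$, and for $N\ge 1$, $\lambda\in\mathbb Z^r$ put $$b^{(N)}_0=(-N\theta,N^2),\quad b^{(N)}_i=(N\alpha_i,0),\quad x^{s^{(N)}_0\lambda}=q^{N(\lambda,\theta)}x^{s_\theta\lambda},\quad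 x^{s^{(N)}_i\lambda}=x^{s_{\alpha_i}\lambda},\quad x^{\omega^{(N)}\lambda}=q^{-N\lambda_r}x^{(\lambda_r,\lambda_1,\dots,\lambda_{r-1})}.$$ The double affine Hecke algebra $\mathbb H^{(N)}$ is the unital associative $\mathbb F$-algebra generated by $T_0,\dots,T_{r-1}$, $\omega^{\pm1}$ and $\mathbb F[x_1^{\pm N},\dots,x_r^{\pm N}]$, with relations: the braid relations of type $\widehat A_{r-1}$ for the $T_j$ (none if $r=2$); $(T_j-k)(T_j+k^{-1})=0$; $\omega\omega^{-1}=1=\omega^{-1}\omega$, $\omega T_j=T_{j+1}\omega$ (indices mod $r$); and for $\lambda\in N\mathbb Z^r$, $$T_jx^\lambda-x^{s_j^{(N)}\lambda}T_j=(k-k^{-1})\frac{x^\lambda-x^{s_j^{(N)}\lambda}}{1-x^{b_j^{(N)}}},\qquad \omega x^\lambda=x^{\omega^{(N)}\lambda}\omega .$$ The metaplectic basic representation $\widehat\pi^{(N)}$ is the representation of $\mathbb H^{(N)}$ on $\mathbb K^{(N)}[x^{\pm1}]=\mathbb K^{(N)}[x_1^{\pm1},\dots,x_r^{\pm1}]$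 by $\mathbb K^{(N)}$-linear operators given, for $\lambda\in\mathbb Z^r$ and $\mu\in N\mathbb Z^r$, by $$\widehat\pi^{(N)}(T_j)x^\lambda=(k-k^{-1})\,\frac{1-(x^{b_j^{(N)}})^{-t/N}}{1-x^{b_j^{(N)}}}\,x^\lambda-k\,g^{(N)}_{-(\lambda,\alpha_j)}\,x^{s_j^{(N)}\lambda},\quad \widehat\pi^{(N)}(x^\mu)x^\lambda=x^{\lambda+\mu},\quad \widehat\pi^{(N)}(\omega)x^\lambda=x^{\omega^{(N)}\lambda},$$ where $t\in N\mathbb Z$ is $(\lambda,\alpha_j)$ minus its remainder in $\{0,\dots,N-1\}$ modulo $N$. Let $\kappa'$ be a positive divisor of $n$ and $m=n/\kappa'$. Let $\phi_{\kappa'}:\mathbb H^{(m)}\to\mathbb H^{(n)}$ be the $\mathbb C(k)$-algebra morphism with $q\mapsto q^{\kappa'^2}$, $T_j\mapsto T_j$ ($0\le j<r$), $\omega\mapsto\omega$, $x^\lambda\mapsto x^{\kappa'\lambda}$ ($\lambda\in m\mathbb Z^r$), and let $\jmath_{\kappa'}:\mathbb K^{(m)}\hookrightarrow\mathbb K^{(n)}$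 be the $\mathbb C(k)$-homomorphism with $q\mapsto q^{\kappa'^2}$, $g^{(m)}_j\mapsto g^{(n)}_{\kappa'j}$ ($j\in\mathbb Z$); denote its image by $\mathbb K^{(n,\kappa')}_{\jmath}$. **Proposition.** The representations $\widehat\pi^{(m)},\widehat\pi^{(n)}$ and the morphisms $\phi_{\kappa'},\jmath_{\kappa'}$ exist and are uniquely determined by the above formulas. The subset $\mathbb K^{(n,\kappa')}_{\jmath}[x^{\pm\kappa'}]\subseteq\mathbb K^{(n)}[x^{\pm1}]$ (Laurent polynomials with coefficients in $\mathbb K^{(n,\kappa')}_{\jmath}$ and exponents in $\kappa'\mathbb Z^r$) is an $\mathbb H^{(m)}$-submodule for the action $\widehat\pi^{(n)}\circ\phi_{\kappa'}$, and $$\sum_\mu c_\mu x^\mu\ \longmapsto\ \sum_\mu\jmath_{\kappa'}(c_\mu)x^{\kappa'\mu}\qquad(c_\mu\in\mathbb K^{(m)})$$ is an isomorphism of $\mathbb H^{(m)}$-modules $(\mathbb K^{(m)}[x^{\pm1}],\widehat\pi^{(m)})\to(\mathbb K^{(n,\kappa')}_{\jmath}[x^{\pm\kappa'}],\widehat\pi^{(n)}\circ\phi_{\kappa'})$.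 In particular, for $\kappa'=n$, $m=1$: $\widehat\pi^{(1)}$ is Cherednik's basic representation, in which $T_j$ acts by $k s_j^{(1)}+(k-k^{-1})(1-x^{b_j^{(1)}})^{-1}(1-s_j^{(1)})$, $\omega$ by $x^\lambda\mapsto x^{\omega^{(1)}\lambda}$ and $x^\mu$ by multiplication; and $(\mathbb K^{(n,n)}_{\jmath}[x^{\pm n}],\widehat\pi^{(n)}\circ\phi_n)$ realises Cherednik's basic representation with $q$ replaced by $q^{n^2}$: the map $\sum_\mu c_\mu x^\mu\mapsto\sum_\mu c_\mu x^{n\mu}$ is an isomorphism of $\mathbb H^{(1)}$-modules onto it from Cherednik's basic representation on $\mathbb K^{(n,n)}_{\jmath}[x^{\pm1}]$ in which $q$ is replaced by $q^{n^2}$ throughout (in particular the scalar $q\in\mathbb H^{(1)}$ acts as $q^{n^2}$). -/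

import Mathlib

noncomputable section

namespace Metaplectic

/-! ### The coefficient fields -/

/-- The field `ℂ(k)`. -/
abbrev Ck : Type := RatFunc ℂ

/-- The field `𝔽 = ℂ(q, k)`, built as `ℂ(k)(q)`. -/
abbrev F : Type := RatFunc Ck

/-- The field `𝕂⁽ⁿ⁾ = 𝔽(g_1, …, g_N)`, where `N = (n-1)/2` for odd `n` and `N = n/2 - 1` for
even `n ≥ 2`. -/
abbrev K (n : ℕ) : Type := FractionRing (MvPolynomial (Fin ((n - 1) / 2)) F)

/-- The indeterminate `k`, viewed in an extension field of `ℂ(k)`. -/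
def kIn (E : Type) [Field E] [Algebra Ck E] : E := algebraMap Ck E RatFunc.X

/-- The indeterminate `q`, viewed in an extension field of `𝔽`. -/
def qIn (E : Type) [Field E] [Algebra F E] : E := algebraMap F E RatFunc.X

/-- The generator `g_{i+1}` of `𝕂⁽ⁿ⁾` over `𝔽`. -/
def gGen (n : ℕ) (i : Fin ((n - 1) / 2)) : K n :=
  algebraMap (MvPolynomial (Fin ((n - 1) / 2)) F) (K n) (MvPolynomial.X i)

/-- The representation parameters `g_j⁽ⁿ⁾` (`j ∈ ℤ`, `n ≥ 1`), depending on a sign `ε` if `n` is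
even: they are `n`-periodic in `j`, `g_0 = -1`, the `g_j` with `0 < j < n/2` are the free
generators, `g_{n/2} = ε⁻¹ k⁻¹` for even `n`, and `g_j = k⁻² (g_{n-j})⁻¹` for `n/2 < j < n`. -/
def g (n : ℕ) (ε : ℤˣ) (j : ℤ) : K n :=
  let s : ℕ := (j % (n : ℤ)).toNat
  if s = 0 then -1
  else if h : s - 1 < (n - 1) / 2 then gGen n ⟨s - 1, h⟩
  else if 2 * s = n then (((ε⁻¹ : ℤˣ) : ℤ) : K n) * (kIn (K n))⁻¹
  else if h : n - s - 1 < (n - 1) / 2 then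
    (kIn (K n)) ^ (-2 : ℤ) * (gGen n ⟨n - s - 1, h⟩)⁻¹
  else 0 -- this last case does not occur for `n ≥ 1`

/-! ### Lattice, simple roots, extended affine Weyl group

Both the standard basis `ε_1, …, ε_r` of `ℤ^r` and the affine simple reflections are indexed by
`ZMod r` (so that `ε_r` has index `0`).  With this indexing `α_j = ε_j - ε_{j+1}` is the
`j`-th simple root for `1 ≤ j < r`, while `α_0 = ε_r - ε_1 = -θ` with `θ` the highest root. -/

/-- The lattice `ℤ^r`. -/
abbrev Lattice (r : ℕ) : Type := ZMod r → ℤ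

/-- The root `α_j = ε_j - ε_{j+1}`; in particular `α_0 = -θ`. -/
def root (r : ℕ) (j : ZMod r) : Lattice r := Pi.single j 1 - Pi.single (j + 1) 1

/-- The pairing `(λ, α_j^∨) = λ_j - λ_{j+1}`; for `j = 0` it is `-(λ, θ^∨)`. -/
def pair {r : ℕ} (l : Lattice r) (j : ZMod r) : ℤ := l j - l (j + 1)

/-- The transposition `s_{α_j} ∈ S_r` acting on `ℤ^r`; for `j = 0` it is `s_θ`. -/
def perm {r : ℕ} (j : ZMod r) (l : Lattice r) : Lattice r := fun i => l (Equiv.swap j (j + 1) i)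

/-- The action of the cycle `s_1 ⋯ s_{r-1}` on `ℤ^r`, which sends `ε_i` to `ε_{i+1}`. -/
def cyc {r : ℕ} (l : Lattice r) : Lattice r := fun i => l (i - 1)

/-- The sublattice `mℤ^r` of `ℤ^r`. -/
def mLattice (r m : ℕ) : AddSubgroup (Lattice r) where
  carrier := {l | ∀ i, (m : ℤ) ∣ l i}
  zero_mem' := fun _ => dvd_zero _
  add_mem' := fun ha hb i => dvd_add (ha i) (hb i)
  neg_mem' := fun ha i => (dvd_neg (a := (m : ℤ))).2 (ha i)

/-- `s_{α_j}` on `mℤ^r`. -/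
def permM {r m : ℕ} (j : ZMod r) (l : mLattice r m) : mLattice r m :=
  ⟨perm j l.1, fun _ => l.2 _⟩

/-- `s_1 ⋯ s_{r-1}` on `mℤ^r`. -/
def cycM {r m : ℕ} (l : mLattice r m) : mLattice r m := ⟨cyc l.1, fun _ => l.2 _⟩

/-- The vector `m α_j` as an element of `mℤ^r`. -/
def mRoot (r m : ℕ) (j : ZMod r) : mLattice r m :=
  ⟨(m : ℤ) • root r j, fun i => ⟨root r j i, by simp⟩⟩

/-- Multiplication by `d` as a map `mℤ^r → nℤ^r`, for `n = d m`. -/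
def scaleM {r m n : ℕ} (d : ℕ) (h : n = d * m) (l : mLattice r m) : mLattice r n :=
  ⟨(d : ℤ) • l.1, fun i => by
    subst h
    simpa using mul_dvd_mul_left (d : ℤ) (l.2 i)⟩

/-- The component in `ℤ` of the affine simple root `b_j⁽ᵐ⁾`: it is `m²` for `j = 0`
and `0` otherwise. -/
def bConst (r m : ℕ) (j : ZMod r) : ℤ := if j = 0 then (m : ℤ) ^ 2 else 0

/-- The affine simple roots `b_0 = (-mθ, m²)` and `b_j = (m α_j, 0)` for `1 ≤ j < r`. -/
def b (r m : ℕ) (j : ZMod r) : Lattice r × ℤ := ((m : ℤ) • root r j, bConst r m j)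

/-- The component in `ℤ` of `s_j⁽ᵐ⁾(λ, 0)`: it is `m (λ, θ^∨)` for `j = 0` and `0` otherwise. -/
def sConst {r : ℕ} (m : ℕ) (j : ZMod r) (l : Lattice r) : ℤ :=
  if j = 0 then -((m : ℤ) * pair l j) else 0

/-- The vector `s_j⁽ᵐ⁾(λ, 0)`. -/
def sAff {r : ℕ} (m : ℕ) (j : ZMod r) (l : Lattice r) : Lattice r × ℤ :=
  (perm j l, sConst m j l)

/-- The vector `ω⁽ᵐ⁾(λ, 0) = (s_1 ⋯ s_{r-1} λ, -m λ_r)`. -/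
def omAff {r : ℕ} (m : ℕ) (l : Lattice r) : Lattice r × ℤ := (cyc l, -((m : ℤ) * l 0))

/-! ### Laurent polynomials -/

/-- The Laurent polynomial ring `E[x^{±1}] = E[x_1^{±1}, …, x_r^{±1}]`. -/
abbrev Laurent (E : Type) [Field E] (r : ℕ) : Type := AddMonoidAlgebra E (Lattice r)

/-- The element `x^{(λ,c)} = q^c x^λ` of the group algebra `E[L]` of a lattice `L`, for a given
scalar `q ∈ E`. -/
def mon {E : Type} [Field E] {L : Type} (q : E) (v : L × ℤ) : AddMonoidAlgebra E L :=
  AddMonoidAlgebra.single v.1 (q ^ v.2)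

/-- The monomial `x^λ`. -/
def xmon {E : Type} [Field E] {r : ℕ} (l : Lattice r) : Laurent E r :=
  AddMonoidAlgebra.single l 1

/-- The quotient `(1 - (x^v)^a) / (1 - x^v)` in `E[x^{±1}]`, for `v ∈ ℤ^r ⊕ ℤ` and `a ∈ ℤ`, written
as a finite geometric sum; see `one_sub_mul_geomQuot`. -/
def geomQuot {E : Type} [Field E] {r : ℕ} (q : E) (v : Lattice r × ℤ) (a : ℤ) : Laurent E r :=
  ∑ i ∈ Finset.Ico 0 a, mon q (i • v) - ∑ i ∈ Finset.Ico a 0, mon q (i • v)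

theorem mon_add {E : Type} [Field E] {r : ℕ} {q : E} (hq : q ≠ 0) (v w : Lattice r × ℤ) :
    mon q (v + w) = mon q v * mon q w := by
  simp [mon, AddMonoidAlgebra.single_mul_single, zpow_add₀ hq]

theorem geomQuot_succ {E : Type} [Field E] {r : ℕ} (q : E) (v : Lattice r × ℤ) (a : ℤ) :
    geomQuot q v (a + 1) = geomQuot q v a + mon q (a • v) := by
  unfold geomQuot
  rcases le_or_gt 0 a with h | h
  · rw [← Finset.insert_Ico_right_eq_Ico_add_one h, Finset.sum_insert (by simp),
      Finset.Ico_eq_empty (by omega : ¬ a < 0), Finset.Ico_eq_empty (by omega : ¬ a + 1 < 0)]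
    simp [add_comm]
  · rw [← Finset.insert_Ico_add_one_left_eq_Ico h, Finset.sum_insert (by simp),
      Finset.Ico_eq_empty (by omega : ¬ 0 < a), Finset.Ico_eq_empty (by omega : ¬ 0 < a + 1)]
    simp

/-- `geomQuot q v a` is the quotient of `1 - (x^v)^a` by `1 - x^v`. -/
theorem one_sub_mul_geomQuot {E : Type} [Field E] {r : ℕ} {q : E} (hq : q ≠ 0)
    (v : Lattice r × ℤ) (a : ℤ) :
    (1 - mon q v) * geomQuot q v a = 1 - mon q (a • v) := by
  have h0 : (mon q ((0 : ℤ) • v) : Laurent E r) = 1 := by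
    simp [mon, AddMonoidAlgebra.one_def]
  have step : ∀ c : ℤ, (mon q ((c + 1) • v) : Laurent E r) = mon q v * mon q (c • v) := by
    intro c
    rw [← mon_add hq, add_smul, one_smul, add_comm]
  induction a using Int.induction_on with
  | zero => rw [h0]; simp [geomQuot]
  | succ i ih => rw [geomQuot_succ, mul_add, ih, step]; ring
  | pred i ih =>
    have h1 := geomQuot_succ q v (-(i : ℤ) - 1)
    have h2 := step (-(i : ℤ) - 1)
    rw [sub_add_cancel] at h1 h2
    rw [h1, mul_add, h2] at ih
    linear_combination ih

/-! ### The double affine Hecke algebra -/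

/-- Generators of the double affine Hecke algebra `ℍ⁽ᵐ⁾`: `T_j` (`j ∈ ℤ/r`), `ω`, `ω⁻¹` and the
monomials `x^λ` (`λ ∈ mℤ^r`). -/
inductive Gen (r m : ℕ) : Type
  | T (j : ZMod r)
  | om
  | omInv
  | X (l : mLattice r m)

/-- The free `𝔽`-algebra on the generators. -/
abbrev Free (r m : ℕ) : Type := FreeAlgebra F (Gen r m)

/-- The free generators. -/
abbrev gen {r m : ℕ} (y : Gen r m) : Free r m := FreeAlgebra.ι F y

/-- The image in the free algebra of a Laurent polynomial `∑ c_λ x^λ ∈ 𝔽[x^{±m}]`. -/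
def evalX {r m : ℕ} (f : AddMonoidAlgebra F (mLattice r m)) : Free r m :=
  f.coeff.sum fun l c => c • gen (Gen.X l)

/-- The defining relations of `ℍ⁽ᵐ⁾`. In the cross relation `cross`, the Laurent polynomial
`d ∈ 𝔽[x^{±m}]` is the quotient `(x^λ - x^{s_j λ}) / (1 - x^{b_j})`. -/
inductive Rel (r m : ℕ) : Free r m → Free r m → Prop
  | braid (h : 3 ≤ r) (j : ZMod r) :
      Rel r m (gen (.T j) * gen (.T (j + 1)) * gen (.T j))
        (gen (.T (j + 1)) * gen (.T j) * gen (.T (j + 1)))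
  | comm (i j : ZMod r) (h₁ : i ≠ j + 1) (h₂ : j ≠ i + 1) :
      Rel r m (gen (.T i) * gen (.T j)) (gen (.T j) * gen (.T i))
  | hecke (j : ZMod r) :
      Rel r m ((gen (.T j) - algebraMap F _ (kIn F)) * (gen (.T j) + algebraMap F _ (kIn F)⁻¹)) 0
  | om_inv : Rel r m (gen .om * gen .omInv) 1
  | inv_om : Rel r m (gen .omInv * gen .om) 1
  | om_T (j : ZMod r) : Rel r m (gen .om * gen (.T j)) (gen (.T (j + 1)) * gen .om)
  | X_zero : Rel r m (gen (.X 0)) 1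
  | X_add (l l' : mLattice r m) : Rel r m (gen (.X (l + l'))) (gen (.X l) * gen (.X l'))
  | cross (j : ZMod r) (l : mLattice r m) (d : AddMonoidAlgebra F (mLattice r m))
      (hd : (1 - mon (qIn F) (mRoot r m j, bConst r m j)) * d =
        mon (qIn F) (l, 0) - mon (qIn F) (permM j l, sConst m j l.1)) :
      Rel r m
        (gen (.T j) * gen (.X l) -
          evalX (mon (qIn F) (permM j l, sConst m j l.1)) * gen (.T j))
        ((kIn F - (kIn F)⁻¹) • evalX d)
  | om_X (l : mLattice r m) :
      Rel r m (gen .om * gen (.X l))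
        (evalX (mon (qIn F) (cycM l, -((m : ℤ) * l.1 0))) * gen .om)

/-- The `GL_r` double affine Hecke algebra `ℍ⁽ᵐ⁾`, an algebra over `𝔽 = ℂ(q, k)`. -/
abbrev DAHA (r m : ℕ) : Type := RingQuot (Rel r m)

/-- The element of `ℍ⁽ᵐ⁾` given by a generator. -/
def gn {r m : ℕ} (y : Gen r m) : DAHA r m := RingQuot.mkAlgHom F (Rel r m) (gen y)

/-! ### Basic representations -/

/-- `t_m(s) = s - r_m(s)`, with `r_m(s)` the remainder of `s` modulo `m`. -/
def tm (m : ℕ) (s : ℤ) : ℤ := s - s % (m : ℤ)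

/-- The metaplectic divided difference operator `∇_j⁽ᵐ⁾` at `x^λ`: the Laurent polynomial
`((1 - (x^{b_j})^{-t/m}) / (1 - x^{b_j})) x^λ` with `t = t_m((λ, α_j^∨))`. -/
def nabla {E : Type} [Field E] {r : ℕ} (m : ℕ) (q : E) (j : ZMod r) (l : Lattice r) :
    Laurent E r :=
  geomQuot q (b r m j) (-(tm m (pair l j) / (m : ℤ))) * xmon l

/-- The coefficient `p_j(λ) = -k g_{-(λ, α_j^∨)}⁽ᵐ⁾`. -/
def p {r : ℕ} (m : ℕ) (ε : ℤˣ) (j : ZMod r) (l : Lattice r) : K m :=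
  -(kIn (K m)) * g m ε (-(pair l j))

/-- `ρ` is the metaplectic basic representation `π̂⁽ᵐ⁾` of `ℍ⁽ᵐ⁾` on `𝕂⁽ᵐ⁾[x^{±1}]`. -/
structure IsMetaplecticBasicRep (r m : ℕ) (ε : ℤˣ)
    (ρ : DAHA r m →ₐ[F] Module.End (K m) (Laurent (K m) r)) : Prop where
  map_T : ∀ (j : ZMod r) (l : Lattice r), ρ (gn (.T j)) (xmon l) =
    (kIn (K m) - (kIn (K m))⁻¹) • nabla m (qIn (K m)) j l +
      p m ε j l • mon (qIn (K m)) (sAff m j l)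
  map_X : ∀ (u : mLattice r m) (l : Lattice r), ρ (gn (.X u)) (xmon l) = xmon (l + u.1)
  map_om : ∀ l : Lattice r, ρ (gn .om) (xmon l) = mon (qIn (K m)) (omAff m l)

/-- `ρ` is Cherednik's basic representation, on Laurent polynomials with coefficients in a field
`E ⊇ ℂ(k)`, with the role of `q` played by `q' ∈ E`: the scalar `q` acts as `q'`, the `x^μ` act by
multiplication, `ω` acts by the cyclic permutation with `q'`-shift, and
`T_j = k s_j + (k - k⁻¹) (1 - x^{b_j})⁻¹ (1 - s_j)` (written without denominators). -/
structure IsCherednikBasicRep (r : ℕ) {E : Type} [Field E] [Algebra Ck E] (q' : E)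
    (ρ : DAHA r 1 →ₐ[Ck] Module.End E (Laurent E r)) : Prop where
  map_q : ρ (algebraMap F (DAHA r 1) (qIn F)) = algebraMap E (Module.End E (Laurent E r)) q'
  map_T : ∀ (j : ZMod r) (l : Lattice r),
    (1 - mon q' (b r 1 j)) * ρ (gn (.T j)) (xmon l) =
      kIn E • ((1 - mon q' (b r 1 j)) * mon q' (sAff 1 j l)) +
        (kIn E - (kIn E)⁻¹) • (xmon l - mon q' (sAff 1 j l))
  map_X : ∀ (u : mLattice r 1) (l : Lattice r), ρ (gn (.X u)) (xmon l) = xmon (l + u.1)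
  map_om : ∀ l : Lattice r, ρ (gn .om) (xmon l) = mon q' (omAff 1 l)

/-! ### Rescaling maps -/

/-- `φ` is the morphism `φ_d : ℍ⁽ᵐ⁾ → ℍ⁽ⁿ⁾` of `ℂ(k)`-algebras (`n = d m`). -/
structure IsPhi (r : ℕ) {m n : ℕ} (d : ℕ) (h : n = d * m) (φ : DAHA r m →ₐ[Ck] DAHA r n) :
    Prop where
  map_q : φ (algebraMap F (DAHA r m) (qIn F)) = algebraMap F (DAHA r n) (qIn F ^ (d ^ 2))
  map_T : ∀ j : ZMod r, φ (gn (.T j)) = gn (.T j)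
  map_om : φ (gn .om) = gn .om
  map_X : ∀ l : mLattice r m, φ (gn (.X l)) = gn (.X (scaleM d h l))

/-- `ψ` is the homomorphism of fields `𝕂⁽ᵐ⁾ → 𝕂⁽ⁿ⁾` over `ℂ(k)` with `q ↦ q^{d²}` and
`g_i⁽ᵐ⁾ ↦ g_{d i}⁽ⁿ⁾`. -/
structure IsJ {m n : ℕ} (d : ℕ) (ε : ℤˣ) (ψ : K m →ₐ[Ck] K n) : Prop where
  map_q : ψ (qIn (K m)) = qIn (K n) ^ (d ^ 2)
  map_g : ∀ i : ℤ, ψ (g m ε i) = g n ε ((d : ℤ) * i)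

/-- The rescaling `∑ c_μ x^μ ↦ ∑ ψ(c_μ) x^{dμ}` of Laurent polynomials. -/
def rescale {E E' : Type} [Field E] [Field E'] {r : ℕ} (ψ : E →+* E') (d : ℕ)
    (f : Laurent E r) : Laurent E' r :=
  f.coeff.sum fun l c => AddMonoidAlgebra.single ((d : ℤ) • l) (ψ c)

/-- The set `E[x^{±d}]` of Laurent polynomials with coefficients in a subfield `E` and with all
exponents in `dℤ^r`. -/
def subLaurent {A : Type} [Field A] [Algebra Ck A] (E : IntermediateField Ck A) (r d : ℕ) :
    Set (Laurent A r) :=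
  {f | (∀ l, f.coeff l ∈ E) ∧ ∀ l, f.coeff l ≠ 0 → l ∈ mLattice r d}

/-- The space `V`, viewed as a left `A`-module through `ρ : A → End_R(V)`. -/
def RepSpace {A R V : Type} [Ring A] [Ring R] [AddCommGroup V] [Module R V]
    (_ρ : A →+* Module.End R V) : Type := V

instance {A R V : Type} [Ring A] [Ring R] [AddCommGroup V] [Module R V]
    (ρ : A →+* Module.End R V) : AddCommGroup (RepSpace ρ) := inferInstanceAs (AddCommGroup V)

instance {A R V : Type} [Ring A] [Ring R] [AddCommGroup V] [Module R V]
    (ρ : A →+* Module.End R V) : Module A (RepSpace ρ) :=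
  letI : Module A V := Module.compHom V ρ
  inferInstanceAs (Module A V)

/-- The identity map `V → RepSpace ρ`. -/
def RepSpace.of {A R V : Type} [Ring A] [Ring R] [AddCommGroup V] [Module R V]
    (ρ : A →+* Module.End R V) : V ≃+ RepSpace ρ := AddEquiv.refl V

theorem RepSpace.smul_of {A R V : Type} [Ring A] [Ring R] [AddCommGroup V] [Module R V]
    (ρ : A →+* Module.End R V) (a : A) (v : V) :
    a • RepSpace.of ρ v = RepSpace.of ρ (ρ a v) := rfl

/-- The submodule `N`, of a space of Laurent polynomials over `A` on which `ℍ⁽¹⁾` acts through `σ`,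
realises Cherednik's basic representation over the subfield `E`, with the role of `q` played by
`a ∈ E`: the map `∑ c_μ x^μ ↦ ∑ c_μ x^{dμ}` is an isomorphism of `ℍ⁽¹⁾`-modules from Cherednik's
basic representation on `E[x^{±1}]` with parameter `a` onto `N`. -/
def RealisesCherednik {A : Type} [Field A] [Algebra Ck A] {r : ℕ} (E : IntermediateField Ck A)
    (a : A) (d : ℕ) (σ : DAHA r 1 →+* Module.End A (Laurent A r))
    (N : Submodule (DAHA r 1) (RepSpace σ)) : Prop :=
  ∃ (q' : E) (ρ : DAHA r 1 →ₐ[Ck] Module.End E (Laurent E r)),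
    (q' : A) = a ∧ IsCherednikBasicRep r q' ρ ∧
    ∃ e : RepSpace ρ.toRingHom ≃ₗ[DAHA r 1] N,
      ∀ f : Laurent E r,
        (e (RepSpace.of _ f) : RepSpace σ) = RepSpace.of _ (rescale E.val.toRingHom d f)

end Metaplectic

end

noncomputable section

namespace Metaplectic

/-! ### Linear operators on Laurent polynomials -/

section Basic

variable {E : Type} [Field E] {r : ℕ}

/-! The substitution x^λ ↦ x^{dλ}, q ↦ q^{d²}, g_j ↦ g_{dj} (with d = κ', n = dm) carries every
formula for level m to the one for level n. It sends x^{b_j} at level m to x^{b_j} at level n,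
because the ℤ-components of b_j, s_j λ and ωλ are quadratic in the scale. The exponent -t/N in the
divided difference is minus the floor of (λ, α_j)/N, and ⌊ds/(dm)⌋ = ⌊s/m⌋. So the rescaling
intertwines the generators (`rescaleHom_heckeOp`, `rescaleHom_omOp`, `rescaleHom_mulX`); it is
injective, and `range_rescaleHom` identifies its image.

Most of the work is the existence of the representation. It uses only three properties of P(s) = -k
g_{-s}: P is n-periodic, P(0) = k, and P(s)P(-s) = 1 when n ∤ s. The cross relation `heckeOp_mul`
follows by clearing the denominator 1 - x^{b_j} in a domain. For j ≠ 0, the cross relation shows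
that the defect (left side minus right side) of a quadratic, braid or commutation relation passes
through multiplication by each x_i^n, up to permuting the x_i^n. Such a defect vanishes once it
kills the monomials with exponents in {0, …, n-1} (`eq_zero_of_box`). On these T_j has constant
coefficients, and a finite computation remains. Conjugation by ω rotates the indices and brings in
T_0 (`relation_shift`).

The map φ_d is not 𝔽-linear, so it is built from the presentation with the scalars of the target
twisted by q ↦ q^{d²} (`SatisfiesRel.exists_ringHom`). The map of coefficient fields extends an
injective map of polynomial rings. For m = 1 periodicity makes P constantly k and the floor trivial,
which gives Cherednik's operators; these are then transported to the image field. -/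

theorem linearMap_ext_xmon {V : Type*} [AddCommMonoid V] [Module E V]
    {f g : Laurent E r →ₗ[E] V} (h : ∀ l, f (xmon l) = g (xmon l)) : f = g := by
  refine AddMonoidAlgebra.lhom_ext' fun l => LinearMap.ext_ring ?_
  exact h l

/-- The linear operator with prescribed values on monomials. -/
def basisMap (v : Lattice r → Laurent E r) : Module.End E (Laurent E r) :=
  (Finsupp.linearCombination E v).comp
    (AddMonoidAlgebra.coeffLinearEquiv (S := E) (M := Lattice r) E).toLinearMap

@[simp]
theorem basisMap_xmon (v : Lattice r → Laurent E r) (l : Lattice r) :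
    basisMap v (xmon l) = v l := by
  change Finsupp.linearCombination E v (Finsupp.single l 1) = v l
  simp

theorem mon_eq_smul_xmon (q : E) (v : Lattice r × ℤ) : mon q v = q ^ v.2 • xmon v.1 := by
  simp [mon, xmon]

theorem mon_zero_snd (q : E) (l : Lattice r) : mon q (l, 0) = xmon l := by
  simp [mon, xmon]

theorem mon_zero (q : E) : mon q (0 : Lattice r × ℤ) = 1 := by
  simp [mon, AddMonoidAlgebra.one_def]

theorem xmon_zero : (xmon 0 : Laurent E r) = 1 := rfl

theorem xmon_add (l l' : Lattice r) : (xmon (l + l') : Laurent E r) = xmon l * xmon l' := by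
  simp [xmon, AddMonoidAlgebra.single_mul_single]

theorem one_sub_mon_ne_zero (q : E) (v : Lattice r × ℤ) (hv : v.1 ≠ 0) :
    (1 : Laurent E r) - mon q v ≠ 0 := by
  rw [sub_ne_zero, AddMonoidAlgebra.one_def, mon]
  intro h
  rw [AddMonoidAlgebra.single_inj] at h
  rcases h with h | h
  · exact hv h.1.symm
  · exact one_ne_zero h.1

theorem geomQuot_zero (q : E) (v : Lattice r × ℤ) : geomQuot q v 0 = 0 := by
  simp [geomQuot]

theorem geomQuot_one (q : E) (v : Lattice r × ℤ) : geomQuot q v 1 = 1 := by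
  have := geomQuot_succ q v 0
  rw [geomQuot_zero, zero_add, zero_add, zero_smul, mon_zero] at this
  exact this

/-- This replaces the remainder in the definition of t by a floor, which is easy to shift by
multiples of n and to rescale. -/
theorem tm_ediv {n : ℕ} (hn : 0 < n) (s : ℤ) : tm n s / (n : ℤ) = s / n := by
  have h : tm n s = (n : ℤ) * (s / n) := by
    have := Int.emod_add_mul_ediv s n
    unfold tm; linarith
  rw [h, Int.mul_ediv_cancel_left _ (by omega)]

end Basic

/-! ### Roots, reflections and their affine constants. -/

section Combinatorics

variable {r : ℕ}

theorem one_ne_zero_zmod (hr : 2 ≤ r) : (1 : ZMod r) ≠ 0 := by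
  have : Fact (1 < r) := ⟨by omega⟩
  exact one_ne_zero

theorem succ_ne_self_zmod (hr : 2 ≤ r) (j : ZMod r) : j + 1 ≠ j := by
  simpa using one_ne_zero_zmod hr

theorem root_ne_zero (hr : 2 ≤ r) (j : ZMod r) : root r j ≠ 0 := by
  intro h
  have := congrFun h j
  simp [root, (succ_ne_self_zmod hr j).symm] at this

theorem sub_pair_smul_root (hr : 2 ≤ r) (j : ZMod r) (l : Lattice r) :
    l - pair l j • root r j = perm j l := by
  have h := succ_ne_self_zmod hr j
  funext i
  by_cases h1 : i = j
  · subst h1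
    simp [pair, root, perm, h.symm]
  · by_cases h2 : i = j + 1
    · subst h2
      simp [pair, root, perm, h]
    · simp [root, perm, h1, h2, Equiv.swap_apply_of_ne_of_ne h1 h2]

theorem pair_add (l l' : Lattice r) (j : ZMod r) : pair (l + l') j = pair l j + pair l' j := by
  simp [pair]; ring

theorem sAff_add (n : ℕ) (j : ZMod r) (l l' : Lattice r) :
    sAff n j (l + l') = sAff n j l + sAff n j l' := by
  refine Prod.ext rfl ?_
  by_cases h : j = 0 <;> simp [sAff, sConst, h, pair_add]
  ring

theorem dvd_pair {n : ℕ} {u : Lattice r} (hu : u ∈ mLattice r n) (j : ZMod r) :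
    (n : ℤ) ∣ pair u j := dvd_sub (hu _) (hu _)

/-- On vectors whose pairing with the root is divisible by n, the affine reflection moves by a whole
multiple of b_j. For j = 0 the constants agree because -e·n² = -n·(ne). -/
theorem sAff_eq_sub (hr : 2 ≤ r) {n : ℕ} {u : Lattice r} (j : ZMod r) {e : ℤ}
    (he : pair u j = n * e) : (-e) • b r n j + (u, 0) = sAff n j u := by
  refine Prod.ext ?_ ?_
  · have := sub_pair_smul_root hr j u
    rw [he, mul_comm, mul_smul] at this
    simp only [b, sAff, ← this]
    change (-e) • (n : ℤ) • root r j + u = _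
    rw [neg_smul]
    abel
  · by_cases h : j = 0
    · subst h
      simp [b, sAff, bConst, sConst, he]
      ring
    · simp [b, sAff, bConst, sConst, h]

end Combinatorics

/-! ### The Demazure--Lusztig operators -/

section Operators

variable {E : Type} [Field E] {r : ℕ}

/-- Multiplication by the monomial `x^u`. -/
def mulX (u : Lattice r) : Module.End E (Laurent E r) := LinearMap.mulLeft E (xmon u)

@[simp]
theorem mulX_apply (u : Lattice r) (f : Laurent E r) : mulX u f = xmon u * f := rfl

theorem mulX_add (u v : Lattice r) :
    (mulX (u + v) : Module.End E (Laurent E r)) = mulX u * mulX v := by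
  refine LinearMap.ext fun f => ?_
  simp [xmon_add, mul_assoc]

theorem mulX_zero : (mulX 0 : Module.End E (Laurent E r)) = 1 := by
  refine LinearMap.ext fun f => ?_
  simp [xmon_zero]

/-- The metaplectic Demazure--Lusztig operator, with an arbitrary coefficient function `P`
in its second term. -/
def heckeOp (r n : ℕ) (q k : E) (P : ℤ → E) (j : ZMod r) : Module.End E (Laurent E r) :=
  basisMap fun l => (k - k⁻¹) • nabla n q j l + P (pair l j) • mon q (sAff n j l)

theorem heckeOp_xmon (n : ℕ) (q k : E) (P : ℤ → E) (j : ZMod r) (l : Lattice r) :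
    heckeOp r n q k P j (xmon l) =
      (k - k⁻¹) • nabla n q j l + P (pair l j) • mon q (sAff n j l) := basisMap_xmon _ _

variable {n : ℕ} {q k : E} {P : ℤ → E}

/-- Clearing the denominator leaves an identity between monomials, in which shifts of the exponent
can be tracked directly. -/
theorem one_sub_mul_heckeOp_xmon (hn : 0 < n) (hq : q ≠ 0) (j : ZMod r) (l : Lattice r) :
    (1 - mon q (b r n j)) * heckeOp r n q k P j (xmon l) =
      (k - k⁻¹) • (xmon l - mon q ((-(pair l j / n)) • b r n j + (l, 0))) +
        P (pair l j) • ((1 - mon q (b r n j)) * mon q (sAff n j l)) := by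
  rw [heckeOp_xmon, mul_add, mul_smul_comm, mul_smul_comm, nabla, tm_ediv hn, ← mul_assoc,
    one_sub_mul_geomQuot hq, sub_mul, one_mul, mon_add hq, mon_zero_snd]

/-- Adding u ∈ nℤ^r to l changes the floor of (l, α_j)/n by exactly e = (u, α_j)/n and leaves P
unchanged by periodicity. The terms containing P therefore cancel, and only the divided difference
of x^u survives. -/
theorem one_sub_mul_heckeOp_xmon_add (hr : 2 ≤ r) (hn : 0 < n) (hq : q ≠ 0)
    (hP : Function.Periodic P n) (j : ZMod r) {u : Lattice r} (hu : u ∈ mLattice r n)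
    (l : Lattice r) :
    (1 - mon q (b r n j)) *
        (heckeOp r n q k P j (xmon (u + l)) - mon q (sAff n j u) * heckeOp r n q k P j (xmon l)) =
      (k - k⁻¹) • ((xmon u - mon q (sAff n j u)) * xmon l) := by
  obtain ⟨e, he⟩ := dvd_pair hu j
  have h1 : pair (u + l) j / n = pair l j / n + e := by
    rw [pair_add, he, add_comm, Int.add_mul_ediv_left _ _ (by omega)]
  have h2 : P (pair (u + l) j) = P (pair l j) := by
    rw [pair_add, he, add_comm, mul_comm]
    simpa using hP.int_mul e (pair l j)
  have h3 : (-(pair (u + l) j / n)) • b r n j + (u + l, 0) =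
      sAff n j u + ((-(pair l j / n)) • b r n j + (l, 0)) := by
    rw [h1, ← sAff_eq_sub hr j he, neg_add, add_smul]
    have : ((u + l, 0) : Lattice r × ℤ) = (u, 0) + (l, 0) := by simp
    rw [this]; abel
  rw [mul_sub, mul_left_comm, one_sub_mul_heckeOp_xmon hn hq, one_sub_mul_heckeOp_xmon hn hq, h2,
    h3, sAff_add, xmon_add, mon_add hq, mon_add hq (sAff n j u) (sAff n j l)]
  simp only [mul_add, mul_smul_comm, sub_mul, mul_sub, smul_sub, one_mul,
    mul_left_comm (mon q (sAff n j u))]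
  abel

theorem one_sub_mul_heckeOp_mul (hr : 2 ≤ r) (hn : 0 < n) (hq : q ≠ 0)
    (hP : Function.Periodic P n) (j : ZMod r) {u : Lattice r} (hu : u ∈ mLattice r n)
    (f : Laurent E r) :
    (1 - mon q (b r n j)) *
        (heckeOp r n q k P j (xmon u * f) - mon q (sAff n j u) * heckeOp r n q k P j f) =
      (k - k⁻¹) • ((xmon u - mon q (sAff n j u)) * f) := by
  have : (LinearMap.mulLeft E (1 - mon q (b r n j))).comp
      ((heckeOp r n q k P j).comp (mulX u) -
        (LinearMap.mulLeft E (mon q (sAff n j u))).comp (heckeOp r n q k P j)) =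
      (k - k⁻¹) • LinearMap.mulLeft E (xmon u - mon q (sAff n j u)) := by
    refine linearMap_ext_xmon fun l => ?_
    have := one_sub_mul_heckeOp_xmon_add (k := k) hr hn hq hP j hu l
    rw [xmon_add] at this
    simpa using this
  exact LinearMap.congr_fun this f

theorem one_sub_mon_b_ne_zero (hr : 2 ≤ r) (hn : 0 < n) (q : E) (j : ZMod r) :
    (1 : Laurent E r) - mon q (b r n j) ≠ 0 :=
  one_sub_mon_ne_zero _ _ (smul_ne_zero (by exact_mod_cast hn.ne') (root_ne_zero hr j))

/-- The cross relation at operator level. The factor 1 - x^{b_j} is nonzero because the root is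
nonzero, and it cancels because Laurent polynomials over a field form a domain. -/
theorem heckeOp_mul (hr : 2 ≤ r) (hn : 0 < n) (hq : q ≠ 0)
    (hP : Function.Periodic P n) (j : ZMod r) {u : Lattice r} (hu : u ∈ mLattice r n)
    {d : Laurent E r}
    (hd : (1 - mon q (b r n j)) * d = xmon u - mon q (sAff n j u)) (f : Laurent E r) :
    heckeOp r n q k P j (xmon u * f) =
      mon q (sAff n j u) * heckeOp r n q k P j f + (k - k⁻¹) • (d * f) := by
  rw [← sub_eq_iff_eq_add']
  apply mul_left_cancel₀ (one_sub_mon_b_ne_zero hr hn q j)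
  rw [one_sub_mul_heckeOp_mul hr hn hq hP j hu, mul_smul_comm, ← mul_assoc, hd]

/-- The vector `n ε_i`. -/
def nbasis (r n : ℕ) (i : ZMod r) : Lattice r := (n : ℤ) • Pi.single i 1

theorem nbasis_mem (i : ZMod r) : nbasis r n i ∈ mLattice r n := fun _ => ⟨_, rfl⟩

theorem sAff_of_ne_zero {j : ZMod r} (hj : j ≠ 0) (l : Lattice r) :
    (mon q (sAff n j l) : Laurent E r) = xmon (perm j l) := by
  rw [← mon_zero_snd q]
  simp [sAff, sConst, hj]

theorem perm_nbasis (i j : ZMod r) : perm j (nbasis r n i) = nbasis r n (Equiv.swap j (j + 1) i) := by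
  funext a
  simp only [perm, nbasis, Pi.smul_apply, Pi.single_apply, Equiv.swap_apply_eq_iff]

theorem mon_b_of_ne_zero {j : ZMod r} (hj : j ≠ 0) :
    (mon q (b r n j) : Laurent E r) = xmon (nbasis r n j - nbasis r n (j + 1)) := by
  rw [← mon_zero_snd q]
  simp [b, bConst, hj, root, nbasis, smul_sub]

theorem heckeOp_mul_mulX_self (hr : 2 ≤ r) (hn : 0 < n) (hq : q ≠ 0)
    (hP : Function.Periodic P n) {j : ZMod r} (hj : j ≠ 0) :
    heckeOp r n q k P j * mulX (nbasis r n j) =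
      mulX (nbasis r n (j + 1)) * heckeOp r n q k P j -
        (k - k⁻¹) • mulX (nbasis r n (j + 1)) := by
  refine LinearMap.ext fun f => ?_
  -- The quotient is explicit: (x_j^n - x_{j+1}^n) / (1 - x_j^n x_{j+1}^{-n}) = -x_{j+1}^n.
  have := heckeOp_mul (k := k) hr hn hq hP j (nbasis_mem j) (d := -xmon (nbasis r n (j + 1))) (by
    rw [mon_b_of_ne_zero hj, sAff_of_ne_zero hj, perm_nbasis, Equiv.swap_apply_left, sub_mul,
      one_mul, mul_neg, ← xmon_add, sub_add_cancel]
    ring) f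
  simp only [Module.End.mul_apply, mulX_apply, this, sAff_of_ne_zero hj, perm_nbasis,
    Equiv.swap_apply_left, LinearMap.sub_apply, LinearMap.smul_apply, neg_mul, smul_neg]
  abel

theorem heckeOp_mul_mulX_succ (hr : 2 ≤ r) (hn : 0 < n) (hq : q ≠ 0)
    (hP : Function.Periodic P n) {j : ZMod r} (hj : j ≠ 0) :
    heckeOp r n q k P j * mulX (nbasis r n (j + 1)) =
      mulX (nbasis r n j) * heckeOp r n q k P j + (k - k⁻¹) • mulX (nbasis r n (j + 1)) := by
  refine LinearMap.ext fun f => ?_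
  have := heckeOp_mul (k := k) hr hn hq hP j (nbasis_mem (j + 1)) (d := xmon (nbasis r n (j + 1)))
    (by
      rw [mon_b_of_ne_zero hj, sAff_of_ne_zero hj, perm_nbasis, Equiv.swap_apply_right, sub_mul,
        one_mul, ← xmon_add, sub_add_cancel]) f
  simp only [Module.End.mul_apply, mulX_apply, this, sAff_of_ne_zero hj, perm_nbasis,
    Equiv.swap_apply_right, LinearMap.add_apply, LinearMap.smul_apply]

theorem heckeOp_mul_mulX_of_ne (hr : 2 ≤ r) (hn : 0 < n) (hq : q ≠ 0)
    (hP : Function.Periodic P n) {i j : ZMod r} (hj : j ≠ 0) (h1 : i ≠ j) (h2 : i ≠ j + 1) :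
    heckeOp r n q k P j * mulX (nbasis r n i) = mulX (nbasis r n i) * heckeOp r n q k P j := by
  refine LinearMap.ext fun f => ?_
  have := heckeOp_mul (k := k) hr hn hq hP j (nbasis_mem i) (d := 0)
    (by rw [sAff_of_ne_zero hj, perm_nbasis, Equiv.swap_apply_of_ne_of_ne h1 h2]; simp) f
  simp only [Module.End.mul_apply, mulX_apply, this, sAff_of_ne_zero hj, perm_nbasis,
    Equiv.swap_apply_of_ne_of_ne h1 h2]
  simp

/-- On monomials `x^l` with all exponents in `{0, …, n-1}`, the operator `T_j` (`j ≠ 0`) has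
constant coefficients. -/
theorem heckeOp_xmon_of_box (hn : 0 < n) {j : ZMod r} (hj : j ≠ 0) {l : Lattice r}
    (hl : ∀ i, 0 ≤ l i ∧ l i < n) :
    heckeOp r n q k P j (xmon l) =
      (if l j < l (j + 1) then k - k⁻¹ else 0) • xmon l + P (pair l j) • xmon (perm j l) := by
  rw [heckeOp_xmon, sAff_of_ne_zero hj, nabla, tm_ediv hn]
  have h1 := hl j
  have h2 := hl (j + 1)
  congr 1
  -- In the box the pairing lies strictly between -n and n, so its floor quotient by n is -1 or 0,
  -- according to the order of the two entries.
  split_ifs with h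
  · have : pair l j / (n : ℤ) = -1 := by
      rw [Int.ediv_eq_iff_of_pos (by omega)]; unfold pair; constructor <;> omega
    rw [this, neg_neg, geomQuot_one, one_mul]
  · have : pair l j / (n : ℤ) = 0 := by
      apply Int.ediv_eq_zero_of_lt <;> unfold pair <;> omega
    rw [this, neg_zero, geomQuot_zero]; simp

/-- An operator vanishes if it commutes, up to permutation, with the `x_i^n`, and vanishes on a set
of representatives of `ℤ^r` modulo `n ℤ^r`. -/
theorem eq_zero_of_box [NeZero r] (hn : 0 < n) (B : Module.End E (Laurent E r))
    (hB : ∀ i, ∃ i', B * mulX (nbasis r n i) = mulX (nbasis r n i') * B)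
    (h : ∀ l : Lattice r, (∀ i, 0 ≤ l i ∧ l i < n) → B (xmon l) = 0) : B = 0 := by
  have step (i : ZMod r) (f : Laurent E r) (a : ℤ) :
      B (xmon (a • nbasis r n i) * f) = 0 ↔ B f = 0 := by
    obtain ⟨i', hi'⟩ := hB i
    -- An equivalence rather than an implication: multiplication by a monomial is injective, and the
    -- direction from x_i^n f back to f handles negative exponents.
    have key (f : Laurent E r) : B (xmon (nbasis r n i) * f) = 0 ↔ B f = 0 := by
      have := LinearMap.congr_fun hi' f
      simp only [Module.End.mul_apply, mulX_apply] at this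
      rw [this, mul_eq_zero, or_iff_right]
      simp [xmon]
    induction a using Int.induction_on with
    | zero => simp [xmon_zero]
    | succ a ih => rw [add_smul, one_smul, add_comm, xmon_add, mul_assoc, key]; exact ih
    | pred a ih =>
      have : nbasis r n i + (-(a : ℤ) - 1) • nbasis r n i = -(a : ℤ) • nbasis r n i := by module
      rw [← key, ← mul_assoc, ← xmon_add, this]
      exact ih
  have all (s : Finset (ZMod r)) (a : ZMod r → ℤ) (f : Laurent E r) :
      B (xmon (∑ i ∈ s, a i • nbasis r n i) * f) = 0 ↔ B f = 0 := by
    induction s using Finset.cons_induction with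
    | empty => simp [xmon_zero]
    | cons i s hi ih => rw [Finset.sum_cons, xmon_add, mul_assoc, step, ih]
  refine linearMap_ext_xmon fun l => ?_
  -- Division with remainder in each coordinate: the quotients give a vector of nℤ^r, the remainders
  -- a point of the box.
  have hl : l = ∑ i, (l i / n) • nbasis r n i + fun i => l i % n := by
    funext j
    simp only [nbasis, Pi.add_apply, Finset.sum_apply, Pi.smul_apply, Pi.single_apply, smul_eq_mul,
      mul_ite, mul_one, mul_zero, Finset.sum_ite_eq, Finset.mem_univ, if_true]
    rw [mul_comm, Int.mul_ediv_add_emod]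
  rw [hl, xmon_add, LinearMap.zero_apply, all]
  exact h _ fun i => ⟨Int.emod_nonneg _ (by omega), Int.emod_lt_of_pos _ (by omega)⟩

end Operators

/-! ### Relations between the Demazure--Lusztig operators -/

section PBW

variable {E A : Type} [Field E] [Ring A] [Algebra E A] {c : E} {t t₁ t₂ x₁ x₂ x₃ : A}

/-- Only the cross relations enter: moving x past t twice restores it, and the correction terms are
absorbed by the linear term c t. -/
theorem quadratic_defect_comm (h1 : t * x₁ = x₂ * t - c • x₂) (h2 : t * x₂ = x₁ * t + c • x₂) :
    (t * t - c • t - 1) * x₁ = x₁ * (t * t - c • t - 1) ∧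
      (t * t - c • t - 1) * x₂ = x₂ * (t * t - c • t - 1) := by
  have h1' (y : A) : t * (x₁ * y) = x₂ * (t * y) - c • (x₂ * y) := by
    rw [← mul_assoc, h1, sub_mul, smul_mul_assoc, mul_assoc]
  have h2' (y : A) : t * (x₂ * y) = x₁ * (t * y) + c • (x₂ * y) := by
    rw [← mul_assoc, h2, add_mul, smul_mul_assoc, mul_assoc]
  constructor <;>
  · simp only [sub_mul, mul_sub, mul_add, mul_assoc, smul_mul_assoc, mul_smul_comm, h1, h2,
      h1', h2', one_mul, mul_one]
    module

/-- Both braid words represent the longest element of S_3, which exchanges x₁ and x₃ and fixes x₂.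
The correction terms contain squares of t₁ and t₂, so the quadratic relations have to be known
beforehand. -/
theorem braid_defect_comm (q1 : t₁ * t₁ = c • t₁ + 1) (q2 : t₂ * t₂ = c • t₂ + 1)
    (h11 : t₁ * x₁ = x₂ * t₁ - c • x₂) (h12 : t₁ * x₂ = x₁ * t₁ + c • x₂) (h13 : t₁ * x₃ = x₃ * t₁)
    (h21 : t₂ * x₁ = x₁ * t₂) (h22 : t₂ * x₂ = x₃ * t₂ - c • x₃)
    (h23 : t₂ * x₃ = x₂ * t₂ + c • x₃) :
    (t₁ * t₂ * t₁ - t₂ * t₁ * t₂) * x₁ = x₃ * (t₁ * t₂ * t₁ - t₂ * t₁ * t₂) ∧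
    (t₁ * t₂ * t₁ - t₂ * t₁ * t₂) * x₂ = x₂ * (t₁ * t₂ * t₁ - t₂ * t₁ * t₂) ∧
    (t₁ * t₂ * t₁ - t₂ * t₁ * t₂) * x₃ = x₁ * (t₁ * t₂ * t₁ - t₂ * t₁ * t₂) := by
  have h11' (y : A) : t₁ * (x₁ * y) = x₂ * (t₁ * y) - c • (x₂ * y) := by
    rw [← mul_assoc, h11, sub_mul, smul_mul_assoc, mul_assoc]
  have h12' (y : A) : t₁ * (x₂ * y) = x₁ * (t₁ * y) + c • (x₂ * y) := by
    rw [← mul_assoc, h12, add_mul, smul_mul_assoc, mul_assoc]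
  have h13' (y : A) : t₁ * (x₃ * y) = x₃ * (t₁ * y) := by rw [← mul_assoc, h13, mul_assoc]
  have h21' (y : A) : t₂ * (x₁ * y) = x₁ * (t₂ * y) := by rw [← mul_assoc, h21, mul_assoc]
  have h22' (y : A) : t₂ * (x₂ * y) = x₃ * (t₂ * y) - c • (x₃ * y) := by
    rw [← mul_assoc, h22, sub_mul, smul_mul_assoc, mul_assoc]
  have h23' (y : A) : t₂ * (x₃ * y) = x₂ * (t₂ * y) + c • (x₃ * y) := by
    rw [← mul_assoc, h23, add_mul, smul_mul_assoc, mul_assoc]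
  refine ⟨?_, ?_, ?_⟩ <;>
  · simp only [sub_mul, mul_sub, mul_add, mul_assoc, mul_smul_comm, h11,
      h12, h13, h21, h22, h23, h11', h12', h13', h21', h22', h23', mul_one, q1, q2]
    module

theorem braid_defect_comm_of_commute {x : A} (h1 : t₁ * x = x * t₁) (h2 : t₂ * x = x * t₂) :
    (t₁ * t₂ * t₁ - t₂ * t₁ * t₂) * x = x * (t₁ * t₂ * t₁ - t₂ * t₁ * t₂) :=
  have h1 : Commute t₁ x := h1
  have h2 : Commute t₂ x := h2
  ((h1.mul_left h2).mul_left h1).sub_left ((h2.mul_left h1).mul_left h2)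

theorem comm_defect_swap {x x' : A} (h : (t₂ * t₁ - t₁ * t₂) * x = x' * (t₂ * t₁ - t₁ * t₂)) :
    (t₁ * t₂ - t₂ * t₁) * x = x' * (t₁ * t₂ - t₂ * t₁) := by
  rw [← neg_sub, neg_mul, h, mul_neg]

end PBW

/-! ### Quadratic and braid relations for constant coefficients. -/

section Box

variable {E V : Type} [Field E] [AddCommGroup V] [Module E V] {k : E} {P : ℤ → E} {S : Set ℤ}

/-- For a ≠ b the formulas give a 2 × 2 block with trace k - k⁻¹ and determinant -P(a-b)P(b-a) = -1,
so the relation is Cayley–Hamilton. For a = b the eigenvalue is P(0) = k. -/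
theorem quadratic_of_box (hk : k ≠ 0) (hP0 : P 0 = k)
    (hPP : ∀ a ∈ S, ∀ b ∈ S, a ≠ b → P (a - b) * P (b - a) = 1) {t : Module.End E V}
    {e : ℤ → ℤ → V} (h : ∀ a ∈ S, ∀ b ∈ S,
      t (e a b) = (if a < b then k - k⁻¹ else 0) • e a b + P (a - b) • e b a)
    {a b : ℤ} (ha : a ∈ S) (hb : b ∈ S) :
    t (t (e a b)) = (k - k⁻¹) • t (e a b) + e a b := by
  simp only [h, ha, hb, map_add, map_smul]
  rcases lt_trichotomy a b with hab | rfl | hab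
  · rw [if_pos hab, if_neg hab.not_gt]
    linear_combination (norm := module) hPP a ha b hb hab.ne • e a b
  · rw [if_neg (lt_irrefl _), sub_self, hP0]
    have hk1 : k * k - (k - k⁻¹) * k - 1 = 0 := by field_simp; ring
    linear_combination (norm := module) hk1 • e a a
  · rw [if_pos hab, if_neg hab.not_gt]
    linear_combination (norm := module) hPP a ha b hb hab.ne' • e a b

/-- This is the braid relation for a constant Hecke-type R-matrix. Coefficients depend only on the
relative order and differences of a, b, c, so it suffices to compare them in each possible ordering.
-/
theorem braid_of_box (hk : k ≠ 0) (hP0 : P 0 = k)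
    (hPP : ∀ a ∈ S, ∀ b ∈ S, a ≠ b → P (a - b) * P (b - a) = 1) {t₁ t₂ : Module.End E V}
    {e : ℤ → ℤ → ℤ → V}
    (h1 : ∀ a ∈ S, ∀ b ∈ S, ∀ c ∈ S,
      t₁ (e a b c) = (if a < b then k - k⁻¹ else 0) • e a b c + P (a - b) • e b a c)
    (h2 : ∀ a ∈ S, ∀ b ∈ S, ∀ c ∈ S,
      t₂ (e a b c) = (if b < c then k - k⁻¹ else 0) • e a b c + P (b - c) • e a c b)
    {a b c : ℤ} (ha : a ∈ S) (hb : b ∈ S) (hc : c ∈ S) :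
    t₁ (t₂ (t₁ (e a b c))) = t₂ (t₁ (t₂ (e a b c))) := by
  have hk1 : k * k - (k - k⁻¹) * k - 1 = 0 := by field_simp; ring
  simp only [h1, h2, ha, hb, hc, map_add, map_smul]
  have hab' := hPP a ha b hb
  have hbc' := hPP b hb c hc
  rcases lt_trichotomy a b with hab | hab | hab <;>
    rcases lt_trichotomy b c with hbc | hbc | hbc <;>
    rcases lt_trichotomy a c with hac | hac | hac
  all_goals first
    | (exfalso; omega)
    | (try subst hab
       try subst hbc
       try subst hac
       simp only [*, not_lt_of_gt, if_true, if_false, sub_self, lt_irrefl] <;>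
       match_scalars <;> grind)

end Box

/-! ### Quadratic, braid and commutation relations for the non-affine indices. -/

section Relations

variable {E : Type} [Field E] {r n : ℕ} {q k : E} {P : ℤ → E}

theorem perm_box {l : Lattice r} (hl : ∀ i, 0 ≤ l i ∧ l i < n) (j : ZMod r) :
    ∀ i, 0 ≤ perm j l i ∧ perm j l i < n := fun _ => hl _

/-- Replace the entries of `l` at `j` and `j + 1`. -/
def setTwo (j : ZMod r) (l : Lattice r) (a b : ℤ) : Lattice r :=
  fun i => if i = j then a else if i = j + 1 then b else l i

theorem setTwo_self (j : ZMod r) (l : Lattice r) : setTwo j l (l j) (l (j + 1)) = l := by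
  funext i; unfold setTwo; split_ifs <;> simp [*]

/-- Replace the entries of `l` at `j`, `j + 1` and `j + 2`. -/
def setThree (j : ZMod r) (l : Lattice r) (a b c : ℤ) : Lattice r :=
  fun i => if i = j then a else if i = j + 1 then b else if i = j + 1 + 1 then c else l i

theorem setThree_self (j : ZMod r) (l : Lattice r) :
    setThree j l (l j) (l (j + 1)) (l (j + 1 + 1)) = l := by
  funext i; unfold setThree; split_ifs <;> simp [*]

theorem mul_sub_swap_eq_one (hPP : ∀ s : ℤ, ¬ (n : ℤ) ∣ s → P s * P (-s) = 1) {a b : ℤ}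
    (ha : a ∈ Set.Ico 0 (n : ℤ)) (hb : b ∈ Set.Ico 0 (n : ℤ)) (hab : a ≠ b) :
    P (a - b) * P (b - a) = 1 := by
  rw [← neg_sub a b]
  refine hPP _ fun hd => hab ?_
  have := Int.eq_zero_of_abs_lt_dvd hd (by
    rw [abs_lt]; constructor <;> linarith [ha.1, ha.2, hb.1, hb.2])
  linarith

theorem heckeOp_quadratic_of_ne_zero [NeZero r] (hr : 2 ≤ r) (hn : 0 < n) (hq : q ≠ 0) (hk : k ≠ 0)
    (hP : Function.Periodic P n) (hP0 : P 0 = k)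
    (hPP : ∀ s : ℤ, ¬ (n : ℤ) ∣ s → P s * P (-s) = 1) {j : ZMod r} (hj : j ≠ 0) :
    heckeOp r n q k P j * heckeOp r n q k P j - (k - k⁻¹) • heckeOp r n q k P j - 1 = 0 := by
  apply eq_zero_of_box hn
  · intro i
    by_cases h1 : i = j
    · subst h1
      exact ⟨_, (quadratic_defect_comm (heckeOp_mul_mulX_self hr hn hq hP hj)
        (heckeOp_mul_mulX_succ hr hn hq hP hj)).1⟩
    by_cases h2 : i = j + 1
    · subst h2
      exact ⟨_, (quadratic_defect_comm (heckeOp_mul_mulX_self hr hn hq hP hj)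
        (heckeOp_mul_mulX_succ hr hn hq hP hj)).2⟩
    have h : Commute _ _ := heckeOp_mul_mulX_of_ne (k := k) hr hn hq hP hj h1 h2
    exact ⟨_, ((h.mul_left h).sub_left (h.smul_left _)).sub_left (Commute.one_left _)⟩
  · intro l hl
    have hpl (a b : ℤ) : perm j (setTwo j l a b) = setTwo j l b a := by
      funext i
      by_cases h1 : i = j
      · subst h1; simp [perm, setTwo, succ_ne_self_zmod hr]
      · by_cases h2 : i = j + 1
        · subst h2; simp [perm, setTwo, succ_ne_self_zmod hr]
        · simp [perm, setTwo, Equiv.swap_apply_of_ne_of_ne h1 h2, h1, h2]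
    -- The entries of l at j and j + 1 vary over the box while the others stay fixed; T_j preserves
    -- the span of the resulting monomials.
    have key := quadratic_of_box (S := Set.Ico 0 (n : ℤ)) hk hP0 (fun a ha b hb => mul_sub_swap_eq_one hPP ha hb)
      (t := heckeOp r n q k P j) (e := fun a b => xmon (setTwo j l a b)) (fun a ha b hb => by
        rw [heckeOp_xmon_of_box hn hj, hpl]
        · simp [setTwo, succ_ne_self_zmod hr, pair]
        · intro i; unfold setTwo; split_ifs; exacts [ha, hb, hl i]) (hl j) (hl (j + 1))
    simp only [setTwo_self] at key
    simp [key]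

theorem setThree_box {j : ZMod r} {l : Lattice r} (hl : ∀ i, 0 ≤ l i ∧ l i < n) {a b c : ℤ}
    (ha : a ∈ Set.Ico 0 (n : ℤ)) (hb : b ∈ Set.Ico 0 (n : ℤ)) (hc : c ∈ Set.Ico 0 (n : ℤ)) :
    ∀ i, 0 ≤ setThree j l a b c i ∧ setThree j l a b c i < n := by
  intro i; unfold setThree; split_ifs; exacts [ha, hb, hc, hl i]

theorem add_two_ne_self_zmod (hr : 3 ≤ r) (j : ZMod r) : j + 1 + 1 ≠ j := by
  intro h
  rw [add_assoc, add_eq_left] at h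
  have h2 : ((2 : ℕ) : ZMod r) = 0 := by push_cast; rw [← h]; norm_num
  rw [ZMod.natCast_eq_zero_iff] at h2
  have := Nat.le_of_dvd (by norm_num) h2
  omega

theorem heckeOp_braid_of_ne_zero [NeZero r] (hr : 3 ≤ r) (hn : 0 < n) (hq : q ≠ 0) (hk : k ≠ 0)
    (hP : Function.Periodic P n) (hP0 : P 0 = k)
    (hPP : ∀ s : ℤ, ¬ (n : ℤ) ∣ s → P s * P (-s) = 1) {j : ZMod r} (hj : j ≠ 0) (hj' : j + 1 ≠ 0) :
    heckeOp r n q k P j * heckeOp r n q k P (j + 1) * heckeOp r n q k P j -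
      heckeOp r n q k P (j + 1) * heckeOp r n q k P j * heckeOp r n q k P (j + 1) = 0 := by
  have hr2 : 2 ≤ r := by omega
  have n1 := succ_ne_self_zmod hr2 j
  have n2 := succ_ne_self_zmod hr2 (j + 1)
  have n3 := add_two_ne_self_zmod hr j
  have quad {i : ZMod r} (hi : i ≠ 0) : heckeOp r n q k P i * heckeOp r n q k P i =
      (k - k⁻¹) • heckeOp r n q k P i + 1 := by
    have := heckeOp_quadratic_of_ne_zero hr2 hn hq hk hP hP0 hPP hi
    rwa [sub_sub, sub_eq_zero] at this
  have comm := braid_defect_comm (quad hj) (quad hj')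
    (heckeOp_mul_mulX_self hr2 hn hq hP hj) (heckeOp_mul_mulX_succ hr2 hn hq hP hj)
    (heckeOp_mul_mulX_of_ne hr2 hn hq hP hj n3 n2)
    (heckeOp_mul_mulX_of_ne hr2 hn hq hP hj' n1.symm n3.symm)
    (heckeOp_mul_mulX_self hr2 hn hq hP hj') (heckeOp_mul_mulX_succ hr2 hn hq hP hj')
  apply eq_zero_of_box hn
  · intro i
    by_cases h1 : i = j
    · subst h1; exact ⟨_, comm.1⟩
    by_cases h2 : i = j + 1
    · subst h2; exact ⟨_, comm.2.1⟩
    by_cases h3 : i = j + 1 + 1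
    · subst h3; exact ⟨_, comm.2.2⟩
    exact ⟨_, braid_defect_comm_of_commute (heckeOp_mul_mulX_of_ne hr2 hn hq hP hj h1 h2)
      (heckeOp_mul_mulX_of_ne hr2 hn hq hP hj' h2 h3)⟩
  · intro l hl
    have hp1 (a b c : ℤ) : perm j (setThree j l a b c) = setThree j l b a c := by
      funext i
      by_cases h1 : i = j
      · subst h1; simp [perm, setThree, n1]
      · by_cases h2 : i = j + 1
        · subst h2; simp [perm, setThree, n1]
        · simp [perm, setThree, Equiv.swap_apply_of_ne_of_ne h1 h2, h1, h2]
    have hp2 (a b c : ℤ) : perm (j + 1) (setThree j l a b c) = setThree j l a c b := by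
      funext i
      by_cases h1 : i = j + 1
      · subst h1; simp [perm, setThree, n1, n3, n2]
      · by_cases h2 : i = j + 1 + 1
        · subst h2; simp [perm, setThree, n1, n3, n2]
        · simp [perm, setThree, Equiv.swap_apply_of_ne_of_ne h1 h2, h1, h2]
    have key := braid_of_box (S := Set.Ico 0 (n : ℤ)) hk hP0
      (fun a ha b hb => mul_sub_swap_eq_one hPP ha hb)
      (t₁ := heckeOp r n q k P j) (t₂ := heckeOp r n q k P (j + 1))
      (e := fun a b c => xmon (setThree j l a b c))
      (fun a ha b hb c hc => by
        rw [heckeOp_xmon_of_box hn hj (setThree_box hl ha hb hc), hp1]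
        simp [setThree, n1, pair])
      (fun a ha b hb c hc => by
        rw [heckeOp_xmon_of_box hn hj' (setThree_box hl ha hb hc), hp2]
        simp [setThree, n1, n2, n3, pair])
      (hl j) (hl (j + 1)) (hl (j + 1 + 1))
    simp only [setThree_self] at key
    simp [key]

/-- The two operators touch disjoint pairs of coordinates. Hence neither transposition changes the
data read by the other operator, and the two expansions on a box monomial agree term by term. -/
theorem heckeOp_comm_of_ne_zero [NeZero r] (hr : 2 ≤ r) (hn : 0 < n) (hq : q ≠ 0)
    (hP : Function.Periodic P n) {i j : ZMod r} (hi : i ≠ 0) (hj : j ≠ 0)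
    (hij : i ≠ j + 1) (hji : j ≠ i + 1) :
    heckeOp r n q k P i * heckeOp r n q k P j - heckeOp r n q k P j * heckeOp r n q k P i = 0 := by
  rcases eq_or_ne i j with rfl | h
  · exact sub_self _
  have h' : i + 1 ≠ j + 1 := by simpa using h
  have aux {i j : ZMod r} (hi : i ≠ 0) (hj : j ≠ 0) (hij : i ≠ j + 1) (hji : j ≠ i + 1)
      (h : i ≠ j) : ∀ a, (a = i ∨ a = i + 1) → ∃ a', (heckeOp r n q k P i * heckeOp r n q k P j -
        heckeOp r n q k P j * heckeOp r n q k P i) * mulX (nbasis r n a) =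
        mulX (nbasis r n a') * (heckeOp r n q k P i * heckeOp r n q k P j -
        heckeOp r n q k P j * heckeOp r n q k P i) := by
    have h' : i + 1 ≠ j + 1 := by simpa using h
    have c1 := heckeOp_mul_mulX_of_ne (k := k) hr hn hq hP hj h hij
    have c2 := heckeOp_mul_mulX_of_ne (k := k) hr hn hq hP hj hji.symm h'
    rintro a (rfl | rfl)
    · refine ⟨a + 1, ?_⟩
      rw [sub_mul, mul_assoc, c1, ← mul_assoc, mul_assoc (heckeOp r n q k P j),
        heckeOp_mul_mulX_self hr hn hq hP hi]
      simp only [mul_sub, sub_mul, mul_smul_comm, smul_mul_assoc, ← mul_assoc, c2]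
      abel
    · refine ⟨i, ?_⟩
      rw [sub_mul, mul_assoc, c2, ← mul_assoc, mul_assoc (heckeOp r n q k P j),
        heckeOp_mul_mulX_succ hr hn hq hP hi]
      simp only [mul_sub, mul_add, add_mul, mul_smul_comm, smul_mul_assoc, ← mul_assoc, c1, c2]
      abel
  apply eq_zero_of_box hn
  · intro a
    by_cases h1 : a = i ∨ a = i + 1
    · exact aux hi hj hij hji h a h1
    by_cases h2 : a = j ∨ a = j + 1
    · obtain ⟨a', ha'⟩ := aux hj hi hji hij h.symm a h2
      exact ⟨a', comm_defect_swap ha'⟩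
    push Not at h1 h2
    have c1 : Commute _ _ := heckeOp_mul_mulX_of_ne (k := k) hr hn hq hP hi h1.1 h1.2
    have c2 : Commute _ _ := heckeOp_mul_mulX_of_ne (k := k) hr hn hq hP hj h2.1 h2.2
    exact ⟨a, (c1.mul_left c2).sub_left (c2.mul_left c1)⟩
  · intro l hl
    have e1 : perm j l i = l i := by simp [perm, Equiv.swap_apply_of_ne_of_ne h hij]
    have e2 : perm j l (i + 1) = l (i + 1) := by
      simp [perm, Equiv.swap_apply_of_ne_of_ne hji.symm h']
    have e3 : perm i l j = l j := by simp [perm, Equiv.swap_apply_of_ne_of_ne h.symm hji]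
    have e4 : perm i l (j + 1) = l (j + 1) := by
      simp [perm, Equiv.swap_apply_of_ne_of_ne hij.symm h'.symm]
    have e5 : perm i (perm j l) = perm j (perm i l) := by
      funext a
      have : Commute (Equiv.swap i (i + 1)) (Equiv.swap j (j + 1)) :=
        (Equiv.Perm.disjoint_swap_swap (by
          simp [h, hij, h', hji.symm, (succ_ne_self_zmod hr _).symm])).commute
      exact congrArg l (DFunLike.congr_fun this.eq.symm a)
    have e6 : pair (perm j l) i = pair l i := by simp [pair, e1, e2]
    have e7 : pair (perm i l) j = pair l j := by simp [pair, e3, e4]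
    have hb {j : ZMod r} (hj : j ≠ 0) {l : Lattice r} (hl : ∀ i, 0 ≤ l i ∧ l i < n) :=
      heckeOp_xmon_of_box (q := q) (k := k) (P := P) hn hj hl
    simp only [LinearMap.sub_apply, Module.End.mul_apply, hb hi hl, hb hj hl, map_add, map_smul,
      hb hi (perm_box hl j), hb hj (perm_box hl i), e1, e2, e3, e4, e5, e6, e7]
    module

end Relations

/-! ### The operator `ω` -/

section Omega

variable {E : Type} [Field E] {r n : ℕ} {q k : E} {P : ℤ → E}

/-- The operator `x^l ↦ x^{ω l}`. -/
def omOp (r n : ℕ) (q : E) : Module.End E (Laurent E r) := basisMap fun l => mon q (omAff n l)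

/-- The inverse of `omOp`. -/
def omInvOp (r n : ℕ) (q : E) : Module.End E (Laurent E r) :=
  basisMap fun l => mon q (fun i => l (i + 1), (n : ℤ) * l 1)

theorem omOp_xmon (l : Lattice r) : omOp r n q (xmon l) = mon q (omAff n l) := basisMap_xmon _ _

theorem omOp_mul_omInvOp (hq : q ≠ 0) : omOp r n q * omInvOp r n q = 1 := by
  refine linearMap_ext_xmon fun l => ?_
  rw [Module.End.mul_apply, omInvOp, basisMap_xmon, mon_eq_smul_xmon, map_smul, omOp_xmon,
    mon_eq_smul_xmon, smul_smul, ← zpow_add₀ hq]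
  have : cyc (fun i => l (i + 1)) = l := by funext i; simp [cyc]
  simp [omAff, this]

theorem omInvOp_mul_omOp (hq : q ≠ 0) : omInvOp r n q * omOp r n q = 1 := by
  refine linearMap_ext_xmon fun l => ?_
  rw [Module.End.mul_apply, omOp_xmon, mon_eq_smul_xmon, map_smul, omInvOp, basisMap_xmon,
    mon_eq_smul_xmon, smul_smul, ← zpow_add₀ hq]
  have : (fun i => cyc l (i + 1)) = l := by funext i; simp [cyc]
  simp only [omAff, this]
  simp [cyc]

/-- `omAff` is additive in l, so the operator is multiplicative on monomials; linearity in each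
factor extends this. -/
theorem omOp_mul (hq : q ≠ 0) (f g : Laurent E r) :
    omOp r n q (f * g) = omOp r n q f * omOp r n q g := by
  have key (l l' : Lattice r) : omOp r n q (xmon l * xmon l') =
      omOp r n q (xmon l) * omOp r n q (xmon l') := by
    rw [← xmon_add, omOp_xmon, omOp_xmon, omOp_xmon, ← mon_add hq]
    congr 1
    refine Prod.ext rfl ?_
    simp only [omAff, Pi.add_apply, Prod.snd_add]; ring
  have h1 (l : Lattice r) : (omOp r n q).comp (LinearMap.mulLeft E (xmon l)) =
      (LinearMap.mulLeft E (omOp r n q (xmon l))).comp (omOp r n q) :=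
    linearMap_ext_xmon fun l' => key l l'
  have h2 : (omOp r n q).comp (LinearMap.mulRight E g) =
      (LinearMap.mulRight E (omOp r n q g)).comp (omOp r n q) :=
    linearMap_ext_xmon fun l => LinearMap.congr_fun (h1 l) g
  exact LinearMap.congr_fun h2 f

theorem omOp_mon (hq : q ≠ 0) (v : Lattice r × ℤ) :
    omOp r n q (mon q v) = mon q (cyc v.1, v.2 - n * v.1 0) := by
  rw [mon_eq_smul_xmon, map_smul, omOp_xmon, mon_eq_smul_xmon, mon_eq_smul_xmon, smul_smul,
    ← zpow_add₀ hq]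
  simp [omAff, sub_eq_add_neg]

theorem cyc_smul (a : ℤ) (l : Lattice r) : cyc (a • l) = a • cyc l := rfl

theorem cyc_root (j : ZMod r) : cyc (root r j) = root r (j + 1) := by
  funext i
  simp [cyc, root, Pi.single_apply, sub_eq_iff_eq_add]

theorem pair_cyc (j : ZMod r) (l : Lattice r) : pair (cyc l) (j + 1) = pair l j := by
  simp [cyc, pair]

theorem perm_cyc (j : ZMod r) (l : Lattice r) : perm (j + 1) (cyc l) = cyc (perm j l) := by
  funext i
  simp only [perm, cyc]
  congr 1
  by_cases h1 : i = j + 1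
  · subst h1; simp
  · by_cases h2 : i = j + 1 + 1
    · subst h2; simp
    · have h3 : i - 1 ≠ j := fun h => h1 (by rw [← h]; ring)
      have h4 : i - 1 ≠ j + 1 := fun h => h2 (by rw [← h]; ring)
      rw [Equiv.swap_apply_of_ne_of_ne h1 h2, Equiv.swap_apply_of_ne_of_ne h3 h4]

/-- The ℤ-component of ω b_j = b_{j+1}: the shift of ω removes the constant n² at j = 0 and creates
it at j + 1 = 0. -/
theorem bConst_succ (hr : 2 ≤ r) (j : ZMod r) :
    bConst r n j - n * ((n : ℤ) * root r j 0) = bConst r n (j + 1) := by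
  have h1 := one_ne_zero_zmod hr
  by_cases h : j = 0
  · subst h
    simp [bConst, root, h1, h1.symm]; ring
  · by_cases h' : j + 1 = 0
    · simp [bConst, root, h, h', Ne.symm h]; ring
    · simp [bConst, root, h, h', Ne.symm h, Ne.symm h']

theorem omOp_geomQuot (hr : 2 ≤ r) (hq : q ≠ 0) (j : ZMod r) (a : ℤ) :
    omOp r n q (geomQuot q (b r n j) a) = geomQuot q (b r n (j + 1)) a := by
  have h (i : ℤ) : omOp r n q (mon q (i • b r n j)) = mon q (i • b r n (j + 1)) := by
    rw [omOp_mon hq]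
    congr 1
    refine Prod.ext ?_ ?_
    · change cyc (i • (n : ℤ) • root r j) = i • (n : ℤ) • root r (j + 1)
      rw [cyc_smul, cyc_smul, cyc_root]
    · change i * bConst r n j - n * (i * (n * root r j 0)) = i * bConst r n (j + 1)
      rw [← bConst_succ hr]; ring
  simp only [geomQuot, map_sub, map_sum, h]

/-- At most one of s_j and s_{j+1} is the affine reflection, so the constants are compared in three
cases; if neither is, the transposition fixes coordinate 0 and the shift of ω is unaffected. -/
theorem omOp_mon_sAff (hr : 2 ≤ r) (hq : q ≠ 0) (j : ZMod r) (l : Lattice r) :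
    omOp r n q (mon q (sAff n j l)) =
      q ^ (-((n : ℤ) * l 0)) • mon q (sAff n (j + 1) (cyc l)) := by
  rw [omOp_mon hq, mon_eq_smul_xmon, mon_eq_smul_xmon, smul_smul, ← zpow_add₀ hq]
  congr 2
  · have h1 := one_ne_zero_zmod hr
    by_cases h : j = 0
    · subst h
      simp [sAff, sConst, pair, perm, h1]; ring
    · by_cases h' : j + 1 = 0
      · have h2 : j = 0 - 1 := by rw [← h']; ring
        simp [sAff, sConst, pair, cyc, perm, h2, h1]; ring
      · simp [sAff, sConst, h', h, perm, Equiv.swap_apply_of_ne_of_ne (Ne.symm h) (Ne.symm h')]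
  · exact (perm_cyc j l).symm

/-- ω is multiplicative, takes b_j to b_{j+1} and s_j to s_{j+1}, and preserves the pairing, hence
also the floor and the value of P. -/
theorem omOp_mul_heckeOp (hr : 2 ≤ r) (hn : 0 < n) (hq : q ≠ 0) (j : ZMod r) :
    omOp r n q * heckeOp r n q k P j = heckeOp r n q k P (j + 1) * omOp r n q := by
  refine linearMap_ext_xmon fun l => ?_
  rw [Module.End.mul_apply, Module.End.mul_apply, omOp_xmon, mon_eq_smul_xmon, map_smul,
    heckeOp_xmon, heckeOp_xmon, map_add, map_smul, map_smul, nabla, omOp_mul hq,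
    omOp_geomQuot hr hq, omOp_mon_sAff hr hq, nabla, omOp_xmon, tm_ediv hn, tm_ediv hn,
    mon_eq_smul_xmon q (omAff n l)]
  simp only [omAff, pair_cyc, mul_smul_comm]
  module

theorem omOp_mul_mulX (hq : q ≠ 0) (u : Lattice r) :
    omOp r n q * mulX u = LinearMap.mulLeft E (mon q (omAff n u)) * omOp r n q := by
  refine LinearMap.ext fun f => ?_
  simp [omOp_mul hq, omOp_xmon]

/-- A relation that is preserved by the shift `T_j ↦ T_{j+1}` up to conjugation holds for all
shifts of the `T_j` if it holds for the `T_j`. -/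
theorem relation_shift {A : Type} [Ring A] [NeZero r] {o o' : A} (ho : o * o' = 1)
    (R : (ZMod r → A) → A)
    (hR : ∀ T : ZMod r → A, (∀ j, o * T j = T (j + 1) * o) → o * R T = R (fun j => T (j + 1)) * o)
    (T : ZMod r → A) (hT : ∀ j, o * T j = T (j + 1) * o) (h : R T = 0) (s : ZMod r) :
    R (fun j => T (j + s)) = 0 := by
  have step (s : ZMod r) (h : R (fun j => T (j + s)) = 0) : R (fun j => T (j + (s + 1))) = 0 := by
    have h1 := hR (fun j => T (j + s)) fun j => by rw [hT, add_right_comm]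
    rw [h, mul_zero] at h1
    have h2 : R (fun j => T (j + 1 + s)) = 0 := by
      rw [← mul_one (R _), ← ho, ← mul_assoc, ← h1, zero_mul]
    simpa only [add_assoc, add_comm s 1] using h2
  have all (m : ℕ) : R (fun j => T (j + (m : ZMod r))) = 0 := by
    induction m with
    | zero => simpa using h
    | succ m ih => simpa using step m ih
  simpa using all s.val

theorem heckeOp_quadratic [NeZero r] (hr : 2 ≤ r) (hn : 0 < n) (hq : q ≠ 0) (hk : k ≠ 0)
    (hP : Function.Periodic P n) (hP0 : P 0 = k)
    (hPP : ∀ s : ℤ, ¬ (n : ℤ) ∣ s → P s * P (-s) = 1) (j : ZMod r) :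
    heckeOp r n q k P j * heckeOp r n q k P j - (k - k⁻¹) • heckeOp r n q k P j - 1 = 0 := by
  have := relation_shift (omOp_mul_omInvOp (n := n) hq)
    (fun T => T 1 * T 1 - (k - k⁻¹) • T 1 - 1) (fun T hT => by
      simp only [mul_sub, sub_mul, mul_smul_comm, smul_mul_assoc, mul_one, one_mul, hT, mul_assoc]
      rw [← mul_assoc, hT, mul_assoc, hT])
    (heckeOp r n q k P) (omOp_mul_heckeOp hr hn hq)
    (heckeOp_quadratic_of_ne_zero hr hn hq hk hP hP0 hPP (one_ne_zero_zmod hr)) (j - 1)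
  simpa using this

theorem heckeOp_braid [NeZero r] (hr : 3 ≤ r) (hn : 0 < n) (hq : q ≠ 0) (hk : k ≠ 0)
    (hP : Function.Periodic P n) (hP0 : P 0 = k)
    (hPP : ∀ s : ℤ, ¬ (n : ℤ) ∣ s → P s * P (-s) = 1) (j : ZMod r) :
    heckeOp r n q k P j * heckeOp r n q k P (j + 1) * heckeOp r n q k P j =
      heckeOp r n q k P (j + 1) * heckeOp r n q k P j * heckeOp r n q k P (j + 1) := by
  have hr2 : 2 ≤ r := by omega
  have h2 : (1 : ZMod r) + 1 ≠ 0 := by simpa using add_two_ne_self_zmod hr 0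
  have := relation_shift (omOp_mul_omInvOp (n := n) hq)
    (fun T => T 1 * T (1 + 1) * T 1 - T (1 + 1) * T 1 * T (1 + 1)) (fun T hT => by
      simp only [mul_sub, sub_mul, ← mul_assoc, hT]
      simp only [mul_assoc, hT])
    (heckeOp r n q k P) (omOp_mul_heckeOp hr2 hn hq)
    (heckeOp_braid_of_ne_zero hr hn hq hk hP hP0 hPP (one_ne_zero_zmod hr2) h2) (j - 1)
  have e1 : (1 : ZMod r) + (j - 1) = j := by ring
  have e2 : (1 : ZMod r) + 1 + (j - 1) = j + 1 := by ring
  simp only [e1, e2] at this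
  exact sub_eq_zero.1 this

theorem heckeOp_comm [NeZero r] (hr : 2 ≤ r) (hn : 0 < n) (hq : q ≠ 0)
    (hP : Function.Periodic P n) {i j : ZMod r} (hij : i ≠ j + 1) (hji : j ≠ i + 1) :
    heckeOp r n q k P i * heckeOp r n q k P j = heckeOp r n q k P j * heckeOp r n q k P i := by
  -- The pair (i, j) is rotated to (1, j - i + 1). Neither index is 0, the second one because i ≠ j
  -- + 1.
  have := relation_shift (omOp_mul_omInvOp (n := n) hq)
    (fun T => T 1 * T (j - i + 1) - T (j - i + 1) * T 1) (fun T hT => by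
      simp only [mul_sub, sub_mul, ← mul_assoc, hT]
      simp only [mul_assoc, hT])
    (heckeOp r n q k P) (omOp_mul_heckeOp hr hn hq)
    (heckeOp_comm_of_ne_zero hr hn hq hP (one_ne_zero_zmod hr)
      (fun h => hij (by linear_combination -h))
      (fun h => hij (by linear_combination h)) (fun h => hji (by linear_combination h))) (i - 1)
  have e1 : (1 : ZMod r) + (i - 1) = i := by ring
  have e2 : j - i + 1 + (i - 1) = j := by ring
  simp only [e1, e2] at this
  exact sub_eq_zero.1 this

end Omega

/-! ### The representation parameters -/

section Parameters

theorem kIn_ne_zero (E : Type) [Field E] [Algebra Ck E] : kIn E ≠ 0 :=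
  (map_ne_zero _).2 RatFunc.X_ne_zero

theorem qIn_ne_zero (E : Type) [Field E] [Algebra F E] : qIn E ≠ 0 :=
  (map_ne_zero _).2 RatFunc.X_ne_zero

theorem algebraMap_kIn (n : ℕ) : algebraMap F (K n) (kIn F) = kIn (K n) :=
  (IsScalarTower.algebraMap_apply Ck F (K n) _).symm

theorem algebraMap_qIn (n : ℕ) : algebraMap F (K n) (qIn F) = qIn (K n) := rfl

theorem algebraMap_qIn_zpow (n : ℕ) (c : ℤ) : algebraMap F (K n) (qIn F ^ c) = qIn (K n) ^ c :=
  map_zpow₀ (algebraMap F (K n)) (qIn F) c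

theorem algebraMap_kIn_inv (n : ℕ) : algebraMap F (K n) (kIn F)⁻¹ = (kIn (K n))⁻¹ :=
  (map_inv₀ (algebraMap F (K n)) (kIn F)).trans (congrArg _ (algebraMap_kIn n))

theorem gGen_ne_zero (n : ℕ) (i : Fin ((n - 1) / 2)) : gGen n i ≠ 0 := by
  unfold gGen
  rw [Ne, IsFractionRing.to_map_eq_zero_iff]
  exact MvPolynomial.X_ne_zero i

variable {n : ℕ} (ε : ℤˣ)

theorem g_periodic : Function.Periodic (g n ε) n := by
  intro j
  simp only [g, Int.add_emod_right]

theorem g_add_mul (j e : ℤ) : g n ε (j + n * e) = g n ε j := by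
  rw [mul_comm]
  exact (g_periodic ε).int_mul e j

theorem g_zero : g n ε 0 = -1 := by simp [g]

theorem g_of_lt {s : ℕ} (hs : 0 < s) (h : 2 * s < n) :
    g n ε s = gGen n ⟨s - 1, by omega⟩ := by
  have h1 : ((s : ℤ) % (n : ℤ)).toNat = s := by
    rw [Int.emod_eq_of_lt (by omega) (by omega)]; simp
  simp only [g, h1]
  rw [if_neg (by omega), dif_pos (by omega)]

theorem g_of_eq {s : ℕ} (hs : 0 < s) (h : 2 * s = n) :
    g n ε s = (((ε⁻¹ : ℤˣ) : ℤ) : K n) * (kIn (K n))⁻¹ := by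
  have h1 : ((s : ℤ) % (n : ℤ)).toNat = s := by
    rw [Int.emod_eq_of_lt (by omega) (by omega)]; simp
  simp only [g, h1]
  rw [if_neg (by omega), dif_neg (by omega), if_pos h]

theorem g_neg_of_lt {s : ℕ} (hs : 0 < s) (h : 2 * s < n) :
    g n ε (-s) = kIn (K n) ^ (-2 : ℤ) * (g n ε s)⁻¹ := by
  have h1 : ((-s : ℤ) % (n : ℤ)).toNat = n - s := by
    rw [← Int.add_emod_right, Int.emod_eq_of_lt (by omega) (by omega)]; omega
  rw [g_of_lt ε hs h]
  simp only [g, h1]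
  rw [if_neg (by omega), dif_neg (by omega), if_neg (by omega), dif_pos (by omega)]
  congr 4
  omega

/-- Residues of smallest absolute value, matching the case distinction in `g`; the midpoint n/2
occurs only with the plus sign. -/
theorem exists_residue (hn : 0 < n) (j : ℤ) : ∃ (s : ℕ) (e : ℤ), 2 * s ≤ n ∧
    (j = s + n * e ∨ (2 * s < n ∧ j = -s + n * e)) := by
  have h1 := Int.emod_nonneg j (b := n) (by omega)
  have h2 := Int.emod_lt_of_pos j (b := n) (by omega)
  have h3 := Int.emod_add_mul_ediv j n
  by_cases h : 2 * (j % n) ≤ n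
  · exact ⟨(j % n).toNat, j / n, by omega, Or.inl (by rw [Int.toNat_of_nonneg h1, h3])⟩
  · exact ⟨(n - j % n).toNat, j / n + 1, by omega, Or.inr ⟨by omega, by
      rw [Int.toNat_of_nonneg (by omega)]; linarith⟩⟩

/-- Away from n/2 this is the rule defining g_{n-s}. At n/2 it holds because ε is a sign, so (ε⁻¹
k⁻¹)² = k⁻². -/
theorem g_mul_g_neg (hn : 0 < n) {j : ℤ} (hj : ¬ (n : ℤ) ∣ j) :
    g n ε j * g n ε (-j) = kIn (K n) ^ (-2 : ℤ) := by
  have hk := kIn_ne_zero (K n)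
  obtain ⟨s, e, hs, h⟩ := exists_residue hn j
  have hs0 : 0 < s := by
    rcases Nat.eq_zero_or_pos s with rfl | h0
    · exact absurd ⟨e, by rcases h with h | ⟨-, h⟩ <;> simpa using h⟩ hj
    · exact h0
  rcases hs.lt_or_eq with hlt | heq
  · have h0 := gGen_ne_zero n ⟨s - 1, by omega⟩
    rw [← g_of_lt ε hs0 hlt] at h0
    have key : g n ε s * g n ε (-s) = kIn (K n) ^ (-2 : ℤ) := by
      rw [g_neg_of_lt ε hs0 hlt]; field_simp
    rcases h with rfl | ⟨-, rfl⟩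
    · rw [show -((s : ℤ) + n * e) = -s + n * (-e) by ring, g_add_mul, g_add_mul, key]
    · rw [show -(-(s : ℤ) + n * e) = s + n * (-e) by ring, g_add_mul, g_add_mul, mul_comm, key]
  · rcases h with rfl | ⟨h, -⟩
    · have hn' : (n : ℤ) = 2 * s := by omega
      rw [show -((s : ℤ) + n * e) = s + n * (-e - 1) by rw [hn']; ring, g_add_mul, g_add_mul,
        g_of_eq ε hs0 heq]
      have h2 : (((ε⁻¹ : ℤˣ) : ℤ) : K n) * (((ε⁻¹ : ℤˣ) : ℤ) : K n) = 1 := by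
        rw [← Int.cast_mul, ← Units.val_mul, Int.units_mul_self]; simp
      rw [mul_mul_mul_comm, h2, zpow_neg, one_mul]
      norm_cast
      rw [pow_two, mul_inv]
    · omega

/-- The coefficient function of the metaplectic Demazure--Lusztig operators. -/
def coeffP (n : ℕ) (ε : ℤˣ) (s : ℤ) : K n := -(kIn (K n)) * g n ε (-s)

theorem coeffP_periodic : Function.Periodic (coeffP n ε) n := by
  intro s
  rw [coeffP, coeffP, neg_add, ← mul_neg_one (n : ℤ), g_add_mul]

theorem coeffP_zero : coeffP n ε 0 = kIn (K n) := by simp [coeffP, g_zero]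

theorem coeffP_mul_neg (hn : 0 < n) (s : ℤ) (hs : ¬ (n : ℤ) ∣ s) :
    coeffP n ε s * coeffP n ε (-s) = 1 := by
  have h := g_mul_g_neg ε hn hs
  have hk := kIn_ne_zero (K n)
  rw [coeffP, coeffP, neg_neg]
  calc _ = kIn (K n) ^ 2 * (g n ε s * g n ε (-s)) := by ring
    _ = 1 := by rw [h]; field_simp

end Parameters

/-! ### Homomorphisms from the double affine Hecke algebra -/

section DAHA

variable {r m : ℕ}

theorem gn_eq (y : Gen r m) : gn y = RingQuot.mkAlgHom F (Rel r m) (gen y) := rfl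

theorem DAHA.induction {C : DAHA r m → Prop} (alg : ∀ c, C (algebraMap F _ c))
    (gens : ∀ y, C (gn y)) (mul : ∀ a b, C a → C b → C (a * b))
    (add : ∀ a b, C a → C b → C (a + b)) (a : DAHA r m) : C a := by
  obtain ⟨a, rfl⟩ := RingQuot.mkAlgHom_surjective F (Rel r m) a
  induction a using FreeAlgebra.induction with
  | grade0 c => simpa using alg c
  | grade1 y => exact gens y
  | mul a b ha hb => rw [map_mul]; exact mul _ _ ha hb
  | add a b ha hb => rw [map_add]; exact add _ _ ha hb

theorem gn_rel {x y : Free r m} (h : Rel r m x y) :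
    RingQuot.mkAlgHom F (Rel r m) x = RingQuot.mkAlgHom F (Rel r m) y :=
  RingQuot.mkAlgHom_rel F h

theorem gn_om_mul_omInv : (gn .om : DAHA r m) * gn .omInv = 1 := by
  simpa [gn_eq] using gn_rel (Rel.om_inv (r := r) (m := m))

theorem gn_omInv_mul_om : (gn .omInv : DAHA r m) * gn .om = 1 := by
  simpa [gn_eq] using gn_rel (Rel.inv_om (r := r) (m := m))

/-- No condition on ω⁻¹ is needed, since inverses are unique. Maps are only ring homomorphisms, so
that φ_d is covered, which moves the scalars of 𝔽. -/
theorem DAHA.ringHom_ext {B : Type*} [Ring B] {f f' : DAHA r m →+* B}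
    (alg : ∀ c, f (algebraMap F _ c) = f' (algebraMap F _ c))
    (hT : ∀ j, f (gn (.T j)) = f' (gn (.T j))) (hom : f (gn .om) = f' (gn .om))
    (hX : ∀ l, f (gn (.X l)) = f' (gn (.X l))) : f = f' := by
  refine RingHom.ext fun a => ?_
  induction a using DAHA.induction with
  | alg c => exact alg c
  | gens y =>
    cases y with
    | T j => exact hT j
    | om => exact hom
    | omInv =>
      have h1 : f (gn .omInv) * f (gn .om) = 1 := by rw [← map_mul, gn_omInv_mul_om, map_one]
      have h2 : f (gn .om) * f' (gn .omInv) = 1 := by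
        rw [hom, ← map_mul, gn_om_mul_omInv, map_one]
      exact left_inv_eq_right_inv h1 h2
    | X l => exact hX l
  | mul a b ha hb => rw [map_mul, map_mul, ha, hb]
  | add a b ha hb => rw [map_add, map_add, ha, hb]

/-- In the free algebra `evalX` is additive but not multiplicative, so an additive comparison map Θ
is the right generality. -/
theorem map_evalX {B : Type*} [Ring B] [Algebra F B] (Φ : Free r m →ₐ[F] B)
    (Θ : AddMonoidAlgebra F (mLattice r m) →+ B)
    (h : ∀ l c, Θ (AddMonoidAlgebra.single l c) = c • Φ (gen (.X l)))
    (f : AddMonoidAlgebra F (mLattice r m)) : Φ (evalX f) = Θ f := by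
  rw [evalX, Finsupp.sum, map_sum]
  conv_rhs => rw [← AddMonoidAlgebra.sum_coeff_single f, Finsupp.sum, map_sum]
  simp [h]

end DAHA

/-! ### The metaplectic basic representation -/

theorem sub_mul_add_of_quadratic {E A : Type} [Field E] [Ring A] [Algebra E A] {k : E} (hk : k ≠ 0)
    {t : A} (h : t * t - (k - k⁻¹) • t - 1 = 0) :
    (t - k • (1 : A)) * (t + k⁻¹ • (1 : A)) = 0 := by
  rw [← h]
  simp only [sub_mul, mul_add, mul_smul_comm, smul_mul_assoc, one_mul, mul_one]
  linear_combination (norm := module) (-(mul_inv_cancel₀ hk)) • (1 : A)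

section Representation

variable {r n : ℕ}

/-- The embedding `𝔽[x^{±n}] → 𝕂[x^{±1}]`. -/
def toLaurent (r n : ℕ) : AddMonoidAlgebra F (mLattice r n) →+* Laurent (K n) r :=
  (AddMonoidAlgebra.mapDomainRingHom (K n) (mLattice r n).subtype).comp
    (AddMonoidAlgebra.mapRingHom _ (algebraMap F (K n)))

theorem toLaurent_single (l : mLattice r n) (c : F) :
    toLaurent r n (AddMonoidAlgebra.single l c) =
      AddMonoidAlgebra.single l.1 (algebraMap F (K n) c) := by
  simp [toLaurent]

theorem toLaurent_mon (l : mLattice r n) (c : ℤ) :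
    toLaurent r n (mon (qIn F) (l, c)) = mon (qIn (K n)) (l.1, c) := by
  rw [mon, toLaurent_single, algebraMap_qIn_zpow, mon]

/-- The operators by which the generators of `ℍ⁽ⁿ⁾` act. -/
def genOp (r n : ℕ) (ε : ℤˣ) : Gen r n → Module.End (K n) (Laurent (K n) r)
  | .T j => heckeOp r n (qIn (K n)) (kIn (K n)) (coeffP n ε) j
  | .om => omOp r n (qIn (K n))
  | .omInv => omInvOp r n (qIn (K n))
  | .X l => mulX l.1

theorem algebraMap_end (c : F) : algebraMap F (Module.End (K n) (Laurent (K n) r)) c =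
    algebraMap F (K n) c • 1 := by
  rw [Algebra.algebraMap_eq_smul_one, algebraMap_smul]

theorem lift_genOp_evalX (ε : ℤˣ) (f : AddMonoidAlgebra F (mLattice r n)) :
    FreeAlgebra.lift F (genOp r n ε) (evalX f) = LinearMap.mulLeft (K n) (toLaurent r n f) :=
  map_evalX _ ((LinearMap.mul (K n) (Laurent (K n) r)).toAddMonoidHom.comp
    (toLaurent r n).toAddMonoidHom) (fun l c => by
      refine linearMap_ext_xmon fun l' => ?_
      simp [toLaurent_single, genOp, xmon, AddMonoidAlgebra.single_mul_single,
        Algebra.algebraMap_eq_smul_one]) f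

theorem lift_genOp_rel (hr : 2 ≤ r) (hn : 0 < n) (ε : ℤˣ) ⦃x y : Free r n⦄ (h : Rel r n x y) :
    FreeAlgebra.lift F (genOp r n ε) x = FreeAlgebra.lift F (genOp r n ε) y := by
  have : NeZero r := ⟨by omega⟩
  have hq := qIn_ne_zero (K n)
  have hk := kIn_ne_zero (K n)
  have hP := coeffP_periodic (n := n) ε
  have hP0 := coeffP_zero (n := n) ε
  have hPP := coeffP_mul_neg ε hn
  cases h with
  | braid h j => simpa [genOp] using heckeOp_braid h hn hq hk hP hP0 hPP j
  | comm i j h1 h2 => simpa [genOp] using heckeOp_comm hr hn hq hP h1 h2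
  | hecke j =>
    have := heckeOp_quadratic hr hn hq hk hP hP0 hPP j
    simp only [map_mul, map_sub, map_add, map_zero, AlgHom.commutes, algebraMap_end,
      FreeAlgebra.lift_ι_apply, genOp, algebraMap_kIn_inv, algebraMap_kIn]
    exact sub_mul_add_of_quadratic hk this
  | om_inv => simpa [genOp] using omOp_mul_omInvOp hq
  | inv_om => simpa [genOp] using omInvOp_mul_omOp hq
  | om_T j => simpa [genOp] using omOp_mul_heckeOp hr hn hq j
  | X_zero => simpa [genOp] using mulX_zero
  | X_add l l' => simpa [genOp] using mulX_add l.1 l'.1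
  | cross j l d hd =>
    -- The quotient d is given over 𝔽; its image over 𝕂 satisfies the same division identity, which
    -- is what `heckeOp_mul` requires.
    have hd' := congrArg (toLaurent r n) hd
    rw [map_mul, map_sub, map_one, map_sub, toLaurent_mon, toLaurent_mon, toLaurent_mon,
      mon_zero_snd] at hd'
    have e : algebraMap F (K n) (kIn F - (kIn F)⁻¹) = kIn (K n) - (kIn (K n))⁻¹ := by
      rw [map_sub, algebraMap_kIn_inv, algebraMap_kIn]
    rw [map_sub, map_mul, map_mul, map_smul, lift_genOp_evalX, lift_genOp_evalX, toLaurent_mon,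
      FreeAlgebra.lift_ι_apply, FreeAlgebra.lift_ι_apply, ← algebraMap_smul (K n), e]
    refine LinearMap.ext fun f => ?_
    have := heckeOp_mul (k := kIn (K n)) hr hn hq hP j l.2 hd' f
    simp only [LinearMap.sub_apply, Module.End.mul_apply, genOp, mulX_apply, this,
      LinearMap.mulLeft_apply, LinearMap.smul_apply]
    exact add_sub_cancel_left _ _
  | om_X l =>
    rw [map_mul, map_mul, lift_genOp_evalX, toLaurent_mon, FreeAlgebra.lift_ι_apply,
      FreeAlgebra.lift_ι_apply]
    exact omOp_mul_mulX hq l.1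

/-- The metaplectic basic representation. -/
def metaplecticRep (hr : 2 ≤ r) (hn : 0 < n) (ε : ℤˣ) :
    DAHA r n →ₐ[F] Module.End (K n) (Laurent (K n) r) :=
  RingQuot.liftAlgHom F ⟨FreeAlgebra.lift F (genOp r n ε), lift_genOp_rel hr hn ε⟩

theorem metaplecticRep_gn (hr : 2 ≤ r) (hn : 0 < n) (ε : ℤˣ) (y : Gen r n) :
    metaplecticRep hr hn ε (gn y) = genOp r n ε y := by
  rw [metaplecticRep, gn_eq, RingQuot.liftAlgHom_mkAlgHom_apply, FreeAlgebra.lift_ι_apply]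

theorem isMetaplecticBasicRep_metaplecticRep (hr : 2 ≤ r) (hn : 0 < n) (ε : ℤˣ) :
    IsMetaplecticBasicRep r n ε (metaplecticRep hr hn ε) where
  map_T j l := by rw [metaplecticRep_gn]; exact heckeOp_xmon _ _ _ _ _ _
  map_X u l := by rw [metaplecticRep_gn, add_comm, xmon_add]; rfl
  map_om l := by rw [metaplecticRep_gn]; exact omOp_xmon _

theorem IsMetaplecticBasicRep.eq {ε : ℤˣ}
    {ρ ρ' : DAHA r n →ₐ[F] Module.End (K n) (Laurent (K n) r)}
    (h : IsMetaplecticBasicRep r n ε ρ) (h' : IsMetaplecticBasicRep r n ε ρ') : ρ = ρ' := by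
  have : ρ.toRingHom = ρ'.toRingHom := by
    refine DAHA.ringHom_ext (fun c => ?_) (fun j => ?_) ?_ (fun l => ?_)
    · exact (ρ.commutes c).trans (ρ'.commutes c).symm
    · exact linearMap_ext_xmon fun l => (h.map_T j l).trans (h'.map_T j l).symm
    · exact linearMap_ext_xmon fun l => (h.map_om l).trans (h'.map_om l).symm
    · exact linearMap_ext_xmon fun l' => (h.map_X l l').trans (h'.map_X l l').symm
  exact AlgHom.ext fun a => RingHom.congr_fun this a

theorem existsUnique_metaplecticRep (hr : 2 ≤ r) (hn : 0 < n) (ε : ℤˣ) :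
    ∃! ρ : DAHA r n →ₐ[F] Module.End (K n) (Laurent (K n) r), IsMetaplecticBasicRep r n ε ρ :=
  ⟨_, isMetaplecticBasicRep_metaplecticRep hr hn ε, fun _ h =>
    h.eq (isMetaplecticBasicRep_metaplecticRep hr hn ε)⟩

theorem IsMetaplecticBasicRep.eq_genOp (hr : 2 ≤ r) (hn : 0 < n) {ε : ℤˣ}
    {ρ : DAHA r n →ₐ[F] Module.End (K n) (Laurent (K n) r)}
    (h : IsMetaplecticBasicRep r n ε ρ) (y : Gen r n) : ρ (gn y) = genOp r n ε y := by
  rw [h.eq (isMetaplecticBasicRep_metaplecticRep hr hn ε), metaplecticRep_gn]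

theorem IsMetaplecticBasicRep.isCherednikBasicRep (hr : 2 ≤ r) {ε : ℤˣ}
    {ρ : DAHA r 1 →ₐ[F] Module.End (K 1) (Laurent (K 1) r)}
    (h : IsMetaplecticBasicRep r 1 ε ρ) :
    IsCherednikBasicRep r (qIn (K 1)) (ρ.restrictScalars Ck) where
  map_q := by
    rw [AlgHom.restrictScalars_apply, AlgHom.commutes, algebraMap_end,
      Algebra.algebraMap_eq_smul_one (A := Module.End (K 1) _), algebraMap_qIn]
  map_T j l := by
    -- Period 1 makes P constant, equal to P(0) = k.
    have hP (s : ℤ) : coeffP 1 ε s = kIn (K 1) := by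
      have := (coeffP_periodic (n := 1) ε).int_mul s 0
      simpa [coeffP_zero] using this
    have h1 : (-(pair l j / ((1 : ℕ) : ℤ))) • b r 1 j + (l, 0) = sAff 1 j l :=
      sAff_eq_sub hr j (by simp)
    have := one_sub_mul_heckeOp_xmon (k := kIn (K 1)) (P := coeffP 1 ε) one_pos
      (qIn_ne_zero (K 1)) j l
    rw [AlgHom.restrictScalars_apply, h.eq_genOp hr one_pos]
    rw [h1, hP] at this
    exact this.trans (add_comm _ _)
  map_X := h.map_X
  map_om := h.map_om

end Representation

/-! ### The substitution `q ↦ q^{d²}` -/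

section Substitution

theorem ratFunc_algHom_ext {A : Type*} [Semiring A] [Algebra Ck A] {f f' : F →ₐ[Ck] A}
    (h : f (qIn F) = f' (qIn F)) : f = f' := by
  apply IsLocalization.algHom_ext (nonZeroDivisors (Polynomial Ck))
  apply Polynomial.algHom_ext
  simpa [qIn, Algebra.algHom] using h

theorem field_map_inv {L : Type*} [Field L] (f : L →+* L) (x : L) : f x⁻¹ = (f x)⁻¹ :=
  map_inv₀ f x

theorem field_map_zpow {L : Type*} [Field L] (f : L →+* L) (x : L) (c : ℤ) : f (x ^ c) = f x ^ c :=
  map_zpow₀ f x c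

theorem field_pow_sq_zpow {L : Type*} [Field L] (x : L) (d : ℕ) (c : ℤ) :
    (x ^ (d ^ 2)) ^ c = x ^ ((d : ℤ) ^ 2 * c) := by
  rw [zpow_mul]
  norm_cast

theorem field_map_injective {L : Type*} [Field L] (f : L →+* L) : Function.Injective f :=
  f.injective

/-- The endomorphism `q ↦ q^{d²}` of `𝔽`. -/
def substQ (d : ℕ) (hd : 0 < d) : F →ₐ[Ck] F :=
  RatFunc.mapAlgHom (Polynomial.expand Ck (d ^ 2))
    (nonZeroDivisors_le_comap_nonZeroDivisors_of_injective _
      (Polynomial.expand_injective (by positivity)))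

theorem substQ_qIn (d : ℕ) (hd : 0 < d) : substQ d hd (qIn F) = qIn F ^ (d ^ 2) := by
  have := RatFunc.map_apply_div (K := Ck) (Polynomial.expand Ck (d ^ 2))
    (nonZeroDivisors_le_comap_nonZeroDivisors_of_injective (Polynomial.expand Ck (d ^ 2))
      (Polynomial.expand_injective (by positivity))) Polynomial.X 1
  simp only [map_one, Polynomial.expand_X, map_pow, RatFunc.algebraMap_X] at this
  exact (congrArg (substQ d hd) (div_one (qIn F)).symm).trans (this.trans (div_one (qIn F ^ (d ^ 2))))

theorem substQ_kIn (d : ℕ) (hd : 0 < d) : substQ d hd (kIn F) = kIn F := (substQ d hd).commutes _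

theorem substQ_kIn_inv (d : ℕ) (hd : 0 < d) : substQ d hd (kIn F)⁻¹ = (kIn F)⁻¹ :=
  (field_map_inv (substQ d hd).toRingHom (kIn F)).trans (congrArg _ (substQ_kIn d hd))

theorem algebraMap_daha {r n : ℕ} (c : Ck) :
    algebraMap Ck (DAHA r n) c = algebraMap F (DAHA r n) (algebraMap Ck F c) := by
  rw [← (RingQuot.mkAlgHom Ck (Rel r n)).commutes, ← (RingQuot.mkAlgHom F (Rel r n)).commutes]
  have h := (RingQuot.mkAlgHom_coe Ck (Rel r n)).trans (RingQuot.mkAlgHom_coe F (Rel r n)).symm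
  exact RingHom.congr_fun h (algebraMap Ck (Free r n) c)

/-- The embedding `𝔽 → ℍ⁽ⁿ⁾`, as a homomorphism of `ℂ(k)`-algebras. -/
def scalarHom (r n : ℕ) : F →ₐ[Ck] DAHA r n where
  toRingHom := algebraMap F (DAHA r n)
  commutes' c := (algebraMap_daha c).symm

end Substitution

/-! ### The morphism `φ_d` -/

section Phi

variable {r m n d : ℕ}

/-- The relations of `ℍ⁽ᵐ⁾` for elements `v y` of a ring, where `σ` gives the action of the scalars
and `Θ` evaluates Laurent polynomials. -/
structure SatisfiesRel {B : Type*} [Ring B] (σ : F →+* B) (v : Gen r m → B)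
    (Θ : AddMonoidAlgebra F (mLattice r m) →+ B) : Prop where
  single (l : mLattice r m) (c : F) : Θ (AddMonoidAlgebra.single l c) = σ c * v (.X l)
  braid (h : 3 ≤ r) (j : ZMod r) :
    v (.T j) * v (.T (j + 1)) * v (.T j) = v (.T (j + 1)) * v (.T j) * v (.T (j + 1))
  comm (i j : ZMod r) (h₁ : i ≠ j + 1) (h₂ : j ≠ i + 1) : v (.T i) * v (.T j) = v (.T j) * v (.T i)
  hecke (j : ZMod r) : (v (.T j) - σ (kIn F)) * (v (.T j) + σ (kIn F)⁻¹) = 0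
  om_inv : v .om * v .omInv = 1
  inv_om : v .omInv * v .om = 1
  om_T (j : ZMod r) : v .om * v (.T j) = v (.T (j + 1)) * v .om
  X_zero : v (.X 0) = 1
  X_add (l l' : mLattice r m) : v (.X (l + l')) = v (.X l) * v (.X l')
  cross (j : ZMod r) (l : mLattice r m) (f : AddMonoidAlgebra F (mLattice r m))
    (hf : (1 - mon (qIn F) (mRoot r m j, bConst r m j)) * f =
      mon (qIn F) (l, 0) - mon (qIn F) (permM j l, sConst m j l.1)) :
    v (.T j) * v (.X l) - Θ (mon (qIn F) (permM j l, sConst m j l.1)) * v (.T j) =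
      σ (kIn F - (kIn F)⁻¹) * Θ f
  om_X (l : mLattice r m) :
    v .om * v (.X l) = Θ (mon (qIn F) (cycM l, -((m : ℤ) * l.1 0))) * v .om

/-- B becomes an 𝔽-algebra through the central map σ, so the universal property over 𝔽 applies even
when σ differs from a given algebra structure on B. -/
theorem SatisfiesRel.exists_ringHom {B : Type*} [Ring B] {σ : F →+* B}
    (hσ : ∀ c x, σ c * x = x * σ c) {v : Gen r m → B}
    {Θ : AddMonoidAlgebra F (mLattice r m) →+ B} (h : SatisfiesRel σ v Θ) :
    ∃ f : DAHA r m →+* B, (∀ c, f (algebraMap F _ c) = σ c) ∧ ∀ y, f (gn y) = v y := by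
  let : Algebra F B := RingHom.toAlgebra' σ hσ
  have gens (y : Gen r m) : FreeAlgebra.lift F v (gen y) = v y := FreeAlgebra.lift_ι_apply _ _
  have eval (f : AddMonoidAlgebra F (mLattice r m)) : FreeAlgebra.lift F v (evalX f) = Θ f :=
    map_evalX _ Θ (fun l c => by rw [gens, Algebra.smul_def]; exact h.single l c) f
  have rel ⦃x y : Free r m⦄ (hxy : Rel r m x y) :
      FreeAlgebra.lift F v x = FreeAlgebra.lift F v y := by
    cases hxy with
    | braid hr j => simpa only [map_mul, gens] using h.braid hr j
    | comm i j h1 h2 => simpa only [map_mul, gens] using h.comm i j h1 h2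
    | hecke j =>
      simp only [map_mul, map_sub, map_add, map_zero, AlgHom.commutes, gens]
      exact h.hecke j
    | om_inv => simpa only [map_mul, map_one, gens] using h.om_inv
    | inv_om => simpa only [map_mul, map_one, gens] using h.inv_om
    | om_T j => simpa only [map_mul, gens] using h.om_T j
    | X_zero => simpa only [map_one, gens] using h.X_zero
    | X_add l l' => simpa only [map_mul, gens] using h.X_add l l'
    | cross j l f hf =>
      rw [map_sub, map_mul, map_mul, map_smul, eval, eval, gens, gens, Algebra.smul_def]
      exact h.cross j l f hf
    | om_X l => rw [map_mul, map_mul, eval, gens, gens]; exact h.om_X l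
  refine ⟨(RingQuot.liftAlgHom F ⟨FreeAlgebra.lift F v, rel⟩).toRingHom, fun c => ?_, fun y => ?_⟩
  · exact (RingQuot.liftAlgHom F ⟨FreeAlgebra.lift F v, rel⟩).commutes c
  · exact (RingQuot.liftAlgHom_mkAlgHom_apply F (FreeAlgebra.lift F v) rel _).trans (gens y)

/-- The images of the generators under `φ_d`. -/
def phiGen (r : ℕ) {m n d : ℕ} (h : n = d * m) : Gen r m → DAHA r n
  | .T j => gn (.T j)
  | .om => gn .om
  | .omInv => gn .omInv
  | .X l => gn (.X (scaleM d h l))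

/-- `scaleM` as a homomorphism of groups. -/
def scaleHom (r : ℕ) {m n d : ℕ} (h : n = d * m) : mLattice r m →+ mLattice r n where
  toFun := scaleM d h
  map_zero' := Subtype.ext (smul_zero _)
  map_add' _ _ := Subtype.ext (smul_add _ _ _)

/-- The map `x^l ↦ x^{dl}`, `q ↦ q^{d²}` on `𝔽[x^{±m}]`. -/
def scaleX (r : ℕ) {m n d : ℕ} (h : n = d * m) (hd : 0 < d) :
    AddMonoidAlgebra F (mLattice r m) →+* AddMonoidAlgebra F (mLattice r n) :=
  (AddMonoidAlgebra.mapDomainRingHom F (scaleHom r h)).comp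
    (AddMonoidAlgebra.mapRingHom _ (substQ d hd).toRingHom)

theorem scaleX_single (h : n = d * m) (hd : 0 < d) (l : mLattice r m) (c : F) :
    scaleX r h hd (AddMonoidAlgebra.single l c) =
      AddMonoidAlgebra.single (scaleM d h l) (substQ d hd c) := by
  simp [scaleX, scaleHom]

theorem scaleX_mon (h : n = d * m) (hd : 0 < d) (l : mLattice r m) (c : ℤ) :
    scaleX r h hd (mon (qIn F) (l, c)) = mon (qIn F) (scaleM d h l, (d : ℤ) ^ 2 * c) := by
  have e : substQ d hd (qIn F ^ c) = qIn F ^ ((d : ℤ) ^ 2 * c) := by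
    refine (field_map_zpow (substQ d hd).toRingHom (qIn F) c).trans ?_
    change substQ d hd (qIn F) ^ c = _
    rw [substQ_qIn]
    exact field_pow_sq_zpow _ _ _
  rw [mon, scaleX_single, e, mon]

theorem evalX_add (f f' : AddMonoidAlgebra F (mLattice r n)) :
    evalX (f + f') = evalX f + evalX f' :=
  Finsupp.sum_add_index' (fun _ => zero_smul _ _) fun _ _ _ => add_smul _ _ _

theorem evalX_single (l : mLattice r n) (c : F) :
    evalX (AddMonoidAlgebra.single l c) = c • gen (Gen.X l) :=
  Finsupp.sum_single_index (zero_smul _ _)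

/-- `evalX` as an additive map to the double affine Hecke algebra. -/
def evalXHom (r n : ℕ) : AddMonoidAlgebra F (mLattice r n) →+ DAHA r n :=
  (RingQuot.mkAlgHom F (Rel r n)).toRingHom.toAddMonoidHom.comp
    { toFun := evalX, map_zero' := Finsupp.sum_zero_index, map_add' := evalX_add }

theorem evalXHom_apply (f : AddMonoidAlgebra F (mLattice r n)) :
    evalXHom r n f = RingQuot.mkAlgHom F (Rel r n) (evalX f) := rfl

theorem evalXHom_single (l : mLattice r n) (c : F) :
    evalXHom r n (AddMonoidAlgebra.single l c) = c • gn (Gen.X l) := by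
  rw [evalXHom_apply, evalX_single, map_smul, gn_eq]

theorem gn_cross (j : ZMod r) (l : mLattice r n) (f : AddMonoidAlgebra F (mLattice r n))
    (hf : (1 - mon (qIn F) (mRoot r n j, bConst r n j)) * f =
      mon (qIn F) (l, 0) - mon (qIn F) (permM j l, sConst n j l.1)) :
    gn (.T j) * gn (.X l) - evalXHom r n (mon (qIn F) (permM j l, sConst n j l.1)) * gn (.T j) =
      (kIn F - (kIn F)⁻¹) • evalXHom r n f := by
  have := gn_rel (Rel.cross j l f hf)
  rwa [map_sub, map_mul, map_mul, map_smul] at this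

theorem gn_hecke (j : ZMod r) : (gn (.T j) - algebraMap F (DAHA r n) (kIn F)) *
    (gn (.T j) + algebraMap F (DAHA r n) (kIn F)⁻¹) = 0 := by
  have := gn_rel (Rel.hecke (r := r) (m := n) j)
  rwa [map_mul, map_sub, map_add, map_zero, AlgHom.commutes, AlgHom.commutes] at this

theorem gn_om_X (l : mLattice r n) : gn .om * gn (.X l) =
    evalXHom r n (mon (qIn F) (cycM l, -((n : ℤ) * l.1 0))) * gn .om := by
  have := gn_rel (Rel.om_X l)
  rwa [map_mul, map_mul] at this

/-- The constant is bilinear in the level and the vector, and both are scaled by d; this is why q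
goes to q^{d²}. -/
theorem sq_mul_sConst (d m : ℕ) (j : ZMod r) (l : Lattice r) :
    (d : ℤ) ^ 2 * sConst m j l = sConst (d * m) j ((d : ℤ) • l) := by
  unfold sConst pair
  split_ifs
  · simp; ring
  · simp

theorem sq_mul_bConst (d m : ℕ) (j : ZMod r) :
    (d : ℤ) ^ 2 * bConst r m j = bConst r (d * m) j := by
  unfold bConst
  split_ifs
  · push_cast; ring
  · simp

theorem satisfiesRel_phiGen (h : n = d * m) (hd : 0 < d) :
    SatisfiesRel ((algebraMap F (DAHA r n)).comp (substQ d hd).toRingHom) (phiGen r h)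
      ((evalXHom r n).comp (scaleX r h hd).toAddMonoidHom) where
  single l c := by
    change evalXHom r n (scaleX r h hd _) = algebraMap F (DAHA r n) (substQ d hd c) * _
    rw [scaleX_single, evalXHom_single, Algebra.smul_def]
    rfl
  braid hr j := by
    have := gn_rel (Rel.braid (m := n) hr j)
    rwa [map_mul, map_mul, map_mul, map_mul] at this
  comm i j h1 h2 := by
    have := gn_rel (Rel.comm (m := n) i j h1 h2)
    rwa [map_mul, map_mul] at this
  hecke j := by
    have := gn_hecke (n := n) j
    -- The substitution fixes k, so the scalars can be rewritten as values of the twisted scalar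
    -- map.
    rw [← substQ_kIn_inv d hd] at this
    nth_rw 1 [← substQ_kIn d hd] at this
    exact this
  om_inv := gn_om_mul_omInv
  inv_om := gn_omInv_mul_om
  om_T j := by
    have := gn_rel (Rel.om_T (m := n) j)
    rwa [map_mul, map_mul] at this
  X_zero := by
    have := gn_rel (Rel.X_zero (r := r) (m := n))
    rw [map_one] at this
    exact (congrArg (fun l => gn (Gen.X l)) (map_zero (scaleHom r h))).trans this
  X_add l l' := by
    have := gn_rel (Rel.X_add (scaleM d h l) (scaleM d h l'))
    rw [map_mul] at this
    exact (congrArg (fun l => gn (Gen.X l)) (map_add (scaleHom r h) l l')).trans this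
  cross j l f hf := by
    have hroot : scaleM d h (mRoot r m j) = mRoot r n j := by
      refine Subtype.ext ?_
      subst h
      change (d : ℤ) • (m : ℤ) • root r j = ((d * m : ℕ) : ℤ) • root r j
      rw [smul_smul]; push_cast; rfl
    have hs : (d : ℤ) ^ 2 * sConst m j l.1 = sConst n j (scaleM d h l).1 := by
      subst h; exact sq_mul_sConst d m j l.1
    have hb : (d : ℤ) ^ 2 * bConst r m j = bConst r n j := by subst h; exact sq_mul_bConst d m j
    have hf' := congrArg (scaleX r h hd) hf
    rw [map_mul, map_sub, map_sub, map_one, scaleX_mon, scaleX_mon, scaleX_mon, mul_zero,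
      hroot, hs, hb] at hf'
    have := gn_cross j _ _ hf'
    change phiGen r h _ * phiGen r h _ - evalXHom r n (scaleX r h hd _) * phiGen r h _ =
      algebraMap F (DAHA r n) (substQ d hd _) * evalXHom r n (scaleX r h hd f)
    rw [scaleX_mon, hs, map_sub, substQ_kIn, substQ_kIn_inv, ← Algebra.smul_def]
    exact this
  om_X l := by
    have hc : (d : ℤ) ^ 2 * -((m : ℤ) * l.1 0) = -((n : ℤ) * (scaleM d h l).1 0) := by
      subst h
      change _ = -(((d * m : ℕ) : ℤ) * ((d : ℤ) * l.1 0))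
      push_cast; ring
    change phiGen r h _ * phiGen r h _ = evalXHom r n (scaleX r h hd _) * phiGen r h _
    rw [scaleX_mon, hc]
    exact gn_om_X (scaleM d h l)

theorem exists_phi (h : n = d * m) (hd : 0 < d) :
    ∃ φ : DAHA r m →ₐ[Ck] DAHA r n, IsPhi r d h φ := by
  obtain ⟨f, hf1, hf2⟩ := (satisfiesRel_phiGen (r := r) h hd).exists_ringHom
    (fun c x => Algebra.commutes (substQ d hd c) x)
  refine ⟨{ f with commutes' := fun c => ?_ }, ⟨?_, fun j => hf2 _, hf2 _, fun l => hf2 _⟩⟩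
  · rw [algebraMap_daha, algebraMap_daha]
    refine (hf1 _).trans ?_
    change algebraMap F (DAHA r n) (substQ d hd _) = _
    rw [AlgHom.commutes]
  · refine (hf1 _).trans ?_
    change algebraMap F (DAHA r n) (substQ d hd _) = _
    rw [substQ_qIn]

theorem IsPhi.map_algebraMap {h : n = d * m} (hd : 0 < d) {φ : DAHA r m →ₐ[Ck] DAHA r n}
    (hφ : IsPhi r d h φ) (c : F) : φ (algebraMap F _ c) = algebraMap F _ (substQ d hd c) := by
  have : φ.comp (scalarHom r m) = (scalarHom r n).comp (substQ d hd) :=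
    ratFunc_algHom_ext (hφ.map_q.trans (by
      change _ = algebraMap F (DAHA r n) (substQ d hd (qIn F))
      rw [substQ_qIn]))
  exact DFunLike.congr_fun this c

theorem existsUnique_phi (h : n = d * m) (hd : 0 < d) :
    ∃! φ : DAHA r m →ₐ[Ck] DAHA r n, IsPhi r d h φ := by
  obtain ⟨φ₀, h₀⟩ := exists_phi (r := r) h hd
  refine ⟨φ₀, h₀, fun φ hφ => ?_⟩
  have : φ.toRingHom = φ₀.toRingHom := by
    refine DAHA.ringHom_ext (fun c => ?_) (fun j => ?_) ?_ (fun l => ?_)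
    · exact (hφ.map_algebraMap hd c).trans (h₀.map_algebraMap hd c).symm
    · exact (hφ.map_T j).trans (h₀.map_T j).symm
    · exact hφ.map_om.trans h₀.map_om.symm
    · exact (hφ.map_X l).trans (h₀.map_X l).symm
  exact AlgHom.ext fun a => RingHom.congr_fun this a

end Phi

/-! ### The embedding of coefficient fields -/

section J

variable {m n d : ℕ}

/-- The index i stands for g_{i+1}; 2(i+1) < m gives 2d(i+1) < n, so g_{d(i+1)} is again a free
generator. -/
theorem scale_index_lt (h : n = d * m) (hd : 0 < d) (i : Fin ((m - 1) / 2)) :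
    d * (i.1 + 1) - 1 < (n - 1) / 2 := by
  have h1 : 2 * (i.1 + 1) + 1 ≤ m := by have := i.2; omega
  have h2 : d * (2 * (i.1 + 1) + 1) ≤ n := h ▸ Nat.mul_le_mul_left d h1
  have h3 : 0 < d * (i.1 + 1) := by positivity
  rw [mul_add, mul_one, mul_left_comm] at h2
  omega

/-- The indices of the images of the generators `g_i⁽ᵐ⁾`. -/
def scaleIndex (h : n = d * m) (hd : 0 < d) (i : Fin ((m - 1) / 2)) : Fin ((n - 1) / 2) :=
  ⟨d * (i.1 + 1) - 1, scale_index_lt h hd i⟩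

theorem scaleIndex_injective (h : n = d * m) (hd : 0 < d) :
    Function.Injective (scaleIndex h hd) := by
  intro i j hij
  have h1 : d * (i.1 + 1) - 1 = d * (j.1 + 1) - 1 := congrArg Fin.val hij
  have h2 : 0 < d * (i.1 + 1) := by positivity
  have h3 : 0 < d * (j.1 + 1) := by positivity
  have h4 : d * (i.1 + 1) = d * (j.1 + 1) := by omega
  have := Nat.eq_of_mul_eq_mul_left hd h4
  exact Fin.ext (by omega)

/-- The restriction of the embedding of coefficient fields to polynomials. -/
def jPoly (h : n = d * m) (hd : 0 < d) :
    MvPolynomial (Fin ((m - 1) / 2)) F →ₐ[Ck] K n :=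
  ((IsScalarTower.toAlgHom Ck (MvPolynomial (Fin ((n - 1) / 2)) F) (K n)).comp
    ((MvPolynomial.rename (R := F) (scaleIndex h hd)).restrictScalars Ck)).comp
      (MvPolynomial.mapAlgHom (substQ d hd))

/-- Needed to pass to fraction fields: distinct variables have distinct images, and q ↦ q^{d²} is
injective on coefficients. -/
theorem jPoly_injective (h : n = d * m) (hd : 0 < d) : Function.Injective (jPoly h hd) := by
  refine (IsFractionRing.injective (MvPolynomial (Fin ((n - 1) / 2)) F) (K n)).comp
    ((MvPolynomial.rename_injective _ (scaleIndex_injective h hd)).comp ?_)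
  exact MvPolynomial.map_injective _ (field_map_injective (substQ d hd).toRingHom)

/-- The embedding of coefficient fields. -/
def jHom (h : n = d * m) (hd : 0 < d) : K m →ₐ[Ck] K n :=
  IsFractionRing.liftAlgHom (jPoly_injective h hd)

theorem jHom_algebraMap (h : n = d * m) (hd : 0 < d) (x : MvPolynomial (Fin ((m - 1) / 2)) F) :
    jHom h hd (algebraMap _ (K m) x) = jPoly h hd x := by
  rw [jHom, IsFractionRing.liftAlgHom_apply]
  exact IsFractionRing.lift_algebraMap _ _

theorem jHom_gGen (h : n = d * m) (hd : 0 < d) (i : Fin ((m - 1) / 2)) :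
    jHom h hd (gGen m i) = gGen n (scaleIndex h hd i) := by
  rw [gGen, jHom_algebraMap]
  simp [jPoly, gGen]

theorem jHom_qIn (h : n = d * m) (hd : 0 < d) : jHom h hd (qIn (K m)) = qIn (K n) ^ (d ^ 2) := by
  rw [qIn, IsScalarTower.algebraMap_apply F (MvPolynomial (Fin ((m - 1) / 2)) F) (K m),
    jHom_algebraMap]
  have : jPoly h hd (algebraMap F _ RatFunc.X) = algebraMap F (K n) (substQ d hd (qIn F)) := by
    rw [IsScalarTower.algebraMap_apply F (MvPolynomial (Fin ((n - 1) / 2)) F) (K n)]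
    simp [jPoly, MvPolynomial.algebraMap_eq, qIn]
  rw [this, substQ_qIn, map_pow, algebraMap_qIn]

theorem algHom_kIn {E E' : Type} [Field E] [Field E'] [Algebra Ck E] [Algebra Ck E']
    (f : E →ₐ[Ck] E') : f (kIn E) = kIn E' := f.commutes _

/-- Multiplication by d takes the ranges s < m/2, s = m/2, s > m/2 to the corresponding ranges at
level n, so the defining cases of g match. -/
theorem jHom_g (hm : 0 < m) (h : n = d * m) (hd : 0 < d) (ε : ℤˣ) (i : ℤ) :
    jHom h hd (g m ε i) = g n ε (d * i) := by
  obtain ⟨s, e, hs, hi⟩ := exists_residue hm i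
  have red (a : ℤ) : g n ε (d * (a + m * e)) = g n ε (d * a) := by
    rw [mul_add, ← mul_assoc, ← Nat.cast_mul, ← h, g_add_mul]
  rcases Nat.eq_zero_or_pos s with rfl | h0
  · have : i = 0 + m * e := by rcases hi with hi | ⟨-, hi⟩ <;> simpa using hi
    rw [this, red, g_add_mul, mul_zero, g_zero, g_zero, map_neg, map_one]
  have h0' : 0 < d * s := by positivity
  rcases hs.lt_or_eq with hlt | heq
  · have hlt' : 2 * (d * s) < n := by
      rw [h, mul_left_comm]; exact Nat.mul_lt_mul_of_pos_left hlt hd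
    have key : jHom h hd (g m ε s) = g n ε (d * s) := by
      have := g_of_lt (n := n) ε h0' hlt'
      push_cast at this
      rw [g_of_lt ε h0 hlt, jHom_gGen, this]
      congr 1
      refine Fin.ext ?_
      change d * (s - 1 + 1) - 1 = d * s - 1
      rw [Nat.sub_add_cancel h0]
    rcases hi with rfl | ⟨-, rfl⟩
    · rw [red, g_add_mul, key]
    · have := g_neg_of_lt (n := n) ε h0' hlt'
      push_cast at this
      rw [red, g_add_mul, g_neg_of_lt ε h0 hlt, mul_neg, this, map_mul, map_zpow₀, map_inv₀, key,
        algHom_kIn]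
  · rcases hi with rfl | ⟨hlt, -⟩
    · have heq' : 2 * (d * s) = n := by rw [h, mul_left_comm, heq]
      have := g_of_eq (n := n) ε h0' heq'
      push_cast at this
      rw [red, g_add_mul, g_of_eq ε h0 heq, this, map_mul, map_inv₀, map_intCast, algHom_kIn]
    · omega

theorem isJ_jHom (hm : 0 < m) (h : n = d * m) (hd : 0 < d) (ε : ℤˣ) : IsJ d ε (jHom h hd) where
  map_q := jHom_qIn h hd
  map_g := jHom_g hm h hd ε

theorem IsJ.map_algebraMap {ε : ℤˣ} (hd : 0 < d) {ψ : K m →ₐ[Ck] K n} (hψ : IsJ d ε ψ) (c : F) :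
    ψ (algebraMap F (K m) c) = algebraMap F (K n) (substQ d hd c) := by
  have : ψ.comp (IsScalarTower.toAlgHom Ck F (K m)) =
      (IsScalarTower.toAlgHom Ck F (K n)).comp (substQ d hd) :=
    ratFunc_algHom_ext (hψ.map_q.trans (by
      change _ = algebraMap F (K n) (substQ d hd (qIn F))
      rw [substQ_qIn, map_pow, algebraMap_qIn]))
  exact DFunLike.congr_fun this c

theorem existsUnique_j (hm : 0 < m) (h : n = d * m) (hd : 0 < d) (ε : ℤˣ) :
    ∃! ψ : K m →ₐ[Ck] K n, IsJ d ε ψ := by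
  refine ⟨jHom h hd, isJ_jHom hm h hd ε, fun ψ hψ => ?_⟩
  have hJ := isJ_jHom hm h hd ε
  have : ψ.toRingHom = (jHom h hd).toRingHom := by
    refine IsLocalization.ringHom_ext
      (nonZeroDivisors (MvPolynomial (Fin ((m - 1) / 2)) F)) ?_
    refine MvPolynomial.ringHom_ext (fun c => ?_) (fun i => ?_)
    · exact (hψ.map_algebraMap hd c).trans (hJ.map_algebraMap hd c).symm
    · have e : algebraMap (MvPolynomial (Fin ((m - 1) / 2)) F) (K m) (MvPolynomial.X i) =
          g m ε ((i.1 + 1 : ℕ) : ℤ) := by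
        rw [g_of_lt ε (Nat.succ_pos _) (by omega)]; rfl
      change ψ (algebraMap _ (K m) _) = jHom h hd (algebraMap _ (K m) _)
      rw [e, hψ.map_g, hJ.map_g]
  exact AlgHom.ext fun a => RingHom.congr_fun this a

end J

/-! ### Rescaling of Laurent polynomials -/

section Rescale

variable {E E' : Type} [Field E] [Field E'] {r : ℕ}

/-- `rescale` as a ring homomorphism. -/
def rescaleHom (ψ : E →+* E') (r d : ℕ) : Laurent E r →+* Laurent E' r :=
  (AddMonoidAlgebra.mapDomainRingHom E' (zsmulAddGroupHom (d : ℤ) : Lattice r →+ Lattice r)).comp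
    (AddMonoidAlgebra.mapRingHom _ ψ)

theorem rescaleHom_single (ψ : E →+* E') (d : ℕ) (l : Lattice r) (c : E) :
    rescaleHom ψ r d (AddMonoidAlgebra.single l c) =
      AddMonoidAlgebra.single ((d : ℤ) • l) (ψ c) := by
  simp [rescaleHom]

theorem rescale_eq (ψ : E →+* E') (d : ℕ) (f : Laurent E r) :
    rescale ψ d f = rescaleHom ψ r d f := by
  conv_rhs => rw [← AddMonoidAlgebra.sum_coeff_single f, Finsupp.sum, map_sum]
  simp only [rescaleHom_single]
  rfl

theorem rescaleHom_xmon (ψ : E →+* E') (d : ℕ) (l : Lattice r) :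
    rescaleHom ψ r d (xmon l) = xmon ((d : ℤ) • l) := by
  rw [xmon, rescaleHom_single, map_one, xmon]

theorem rescaleHom_smul (ψ : E →+* E') (d : ℕ) (c : E) (f : Laurent E r) :
    rescaleHom ψ r d (c • f) = ψ c • rescaleHom ψ r d f := by
  have h (L : Type) [Field L] (a : L) (x : Laurent L r) :
      a • x = AddMonoidAlgebra.single 0 a * x := by
    ext l
    simp
  rw [h, map_mul, rescaleHom_single, smul_zero, ← h]

theorem smul_left_injective_lattice {d : ℕ} (hd : 0 < d) :
    Function.Injective ((d : ℤ) • · : Lattice r → Lattice r) :=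
  smul_right_injective _ (by omega)

theorem rescaleHom_injective (ψ : E →+* E') {d : ℕ} (hd : 0 < d) :
    Function.Injective (rescaleHom ψ r d) := by
  refine Function.Injective.comp (g := AddMonoidAlgebra.mapDomain _)
    (f := AddMonoidAlgebra.map _) (AddMonoidAlgebra.mapDomain_injective ?_)
    (AddMonoidAlgebra.map_injective _ ψ.injective)
  exact smul_left_injective_lattice hd

theorem range_rescaleHom [Algebra Ck E] [Algebra Ck E'] (ψ : E →ₐ[Ck] E') {d : ℕ} (hd : 0 < d)
    (f : Laurent E' r) :
    (∃ f', rescaleHom ψ.toRingHom r d f' = f) ↔ f ∈ subLaurent ψ.fieldRange r d := by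
  have inj := smul_left_injective_lattice (r := r) hd
  constructor
  · rintro ⟨f', rfl⟩
    have hc (l : Lattice r) : (rescaleHom ψ.toRingHom r d f').coeff l =
        (Finsupp.mapDomain ((d : ℤ) • · : Lattice r → Lattice r)
          (AddMonoidAlgebra.map ψ.toRingHom.toAddMonoidHom f').coeff) l := rfl
    refine ⟨fun l => ?_, fun l hl => ?_⟩
    · rw [hc]
      by_cases h : l ∈ Set.range ((d : ℤ) • · : Lattice r → Lattice r)
      · obtain ⟨l', rfl⟩ := h
        rw [Finsupp.mapDomain_apply inj]
        exact ⟨f'.coeff l', rfl⟩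
      · rw [Finsupp.mapDomain_of_notMem_range _ _ h]
        exact zero_mem _
    · rw [hc] at hl
      by_contra h
      refine hl (Finsupp.mapDomain_of_notMem_range _ _ ?_)
      rintro ⟨l', rfl⟩
      exact h fun i => ⟨l' i, rfl⟩
  · rintro ⟨h1, h2⟩
    have h3 : (f.coeff.support : Set (Lattice r)) ⊆
        Set.range ((d : ℤ) • · : Lattice r → Lattice r) := by
      intro l hl
      have := h2 l (by simpa using hl)
      choose e he using this
      exact ⟨e, funext fun i => (he i).symm⟩
    -- The preimage is built in two stages: exponents are divided by d, then coefficients are lifted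
    -- through ψ.
    have h4 : AddMonoidAlgebra.comapDomain _ inj f ∈
        Set.range (AddMonoidAlgebra.map (M := Lattice r) ψ.toRingHom.toAddMonoidHom) := by
      rw [AddMonoidAlgebra.range_map]
      intro l
      exact h1 _
    obtain ⟨f', hf'⟩ := h4
    refine ⟨f', ?_⟩
    refine Eq.trans ?_ (AddMonoidAlgebra.mapDomain_comapDomain h3 inj)
    rw [← hf']
    rfl

variable {ψ : E →+* E'} {q k : E} {q' k' : E'} {m n d : ℕ}

theorem rescaleHom_mon (hq : ψ q = q' ^ (d ^ 2)) (v : Lattice r × ℤ) :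
    rescaleHom ψ r d (mon q v) = mon q' ((d : ℤ) • v.1, (d : ℤ) ^ 2 * v.2) := by
  rw [mon, rescaleHom_single, map_zpow₀, hq, field_pow_sq_zpow, mon]

theorem rescaleHom_geomQuot (hq : ψ q = q' ^ (d ^ 2)) (h : n = d * m) (j : ZMod r) (a : ℤ) :
    rescaleHom ψ r d (geomQuot q (b r m j) a) = geomQuot q' (b r n j) a := by
  have key (i : ℤ) : rescaleHom ψ r d (mon q (i • b r m j)) = mon q' (i • b r n j) := by
    rw [rescaleHom_mon hq]
    subst h
    congr 1
    refine Prod.ext ?_ ?_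
    · change (d : ℤ) • i • (m : ℤ) • root r j = i • ((d * m : ℕ) : ℤ) • root r j
      rw [smul_comm, smul_smul (d : ℤ)]
      push_cast
      rfl
    · change (d : ℤ) ^ 2 * (i * bConst r m j) = i * bConst r (d * m) j
      rw [← sq_mul_bConst]; ring
  simp only [geomQuot, map_sub, map_sum, key]

theorem rescaleHom_comm_of_xmon {A : Module.End E (Laurent E r)} {B : Module.End E' (Laurent E' r)}
    (h : ∀ l, rescaleHom ψ r d (A (xmon l)) = B (xmon ((d : ℤ) • l))) (f : Laurent E r) :
    rescaleHom ψ r d (A f) = B (rescaleHom ψ r d f) := by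
  have hs (l : Lattice r) (c : E) : (AddMonoidAlgebra.single l c : Laurent E r) = c • xmon l := by
    simp [xmon]
  rw [← AddMonoidAlgebra.sum_coeff_single f, Finsupp.sum]
  simp only [map_sum]
  refine Finset.sum_congr rfl fun l _ => ?_
  rw [hs, map_smul, rescaleHom_smul, rescaleHom_smul, map_smul, h, rescaleHom_xmon]

theorem pair_smul (a : ℤ) (j : ZMod r) (l : Lattice r) : pair (a • l) j = a * pair l j := by
  simp [pair, mul_sub]

theorem rescaleHom_heckeOp (hm : 0 < m) (hd : 0 < d) (h : n = d * m) (hq : ψ q = q' ^ (d ^ 2))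
    (hk : ψ k = k') {P : ℤ → E} {P' : ℤ → E'} (hP : ∀ s, ψ (P s) = P' (d * s)) (j : ZMod r)
    (f : Laurent E r) :
    rescaleHom ψ r d (heckeOp r m q k P j f) = heckeOp r n q' k' P' j (rescaleHom ψ r d f) := by
  refine rescaleHom_comm_of_xmon (fun l => ?_) f
  have hn : 0 < n := h ▸ Nat.mul_pos hd hm
  -- The length of the geometric sum is the same at both levels.
  have h1 : (d : ℤ) * pair l j / n = pair l j / m := by
    rw [h, Nat.cast_mul, Int.mul_ediv_mul_of_pos _ _ (by omega)]
  have h2 : rescaleHom ψ r d (mon q (sAff m j l)) = mon q' (sAff n j ((d : ℤ) • l)) := by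
    rw [rescaleHom_mon hq]
    congr 1
    refine Prod.ext rfl ?_
    subst h
    exact sq_mul_sConst d m j l
  rw [heckeOp_xmon, heckeOp_xmon, map_add, rescaleHom_smul, rescaleHom_smul, h2, nabla, nabla,
    map_mul, rescaleHom_geomQuot hq h, rescaleHom_xmon, tm_ediv hm, tm_ediv hn, pair_smul, h1, hP,
    map_sub, map_inv₀, hk]

theorem rescaleHom_omOp (h : n = d * m) (hq : ψ q = q' ^ (d ^ 2)) (f : Laurent E r) :
    rescaleHom ψ r d (omOp r m q f) = omOp r n q' (rescaleHom ψ r d f) := by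
  refine rescaleHom_comm_of_xmon (fun l => ?_) f
  rw [omOp_xmon, omOp_xmon, rescaleHom_mon hq]
  congr 1
  refine Prod.ext rfl ?_
  subst h
  change (d : ℤ) ^ 2 * -((m : ℤ) * l 0) = -(((d * m : ℕ) : ℤ) * ((d : ℤ) * l 0))
  push_cast; ring

theorem rescaleHom_mulX (u : Lattice r) (f : Laurent E r) :
    rescaleHom ψ r d (mulX u f) = mulX ((d : ℤ) • u) (rescaleHom ψ r d f) := by
  rw [mulX_apply, map_mul, rescaleHom_xmon, mulX_apply]

end Rescale

/-! ### The isomorphism of modules -/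

section Main

variable {r m n d : ℕ} {ε : ℤˣ}

theorem rescaleHom_intertwines (hr : 2 ≤ r) (hm : 0 < m) (hd : 0 < d) (h : n = d * m)
    {πm : DAHA r m →ₐ[F] Module.End (K m) (Laurent (K m) r)}
    {πn : DAHA r n →ₐ[F] Module.End (K n) (Laurent (K n) r)}
    {φ : DAHA r m →ₐ[Ck] DAHA r n} {ψ : K m →ₐ[Ck] K n}
    (hπm : IsMetaplecticBasicRep r m ε πm) (hπn : IsMetaplecticBasicRep r n ε πn)
    (hφ : IsPhi r d h φ) (hψ : IsJ d ε ψ) (a : DAHA r m) (f : Laurent (K m) r) :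
    rescaleHom ψ.toRingHom r d (πm a f) = πn (φ a) (rescaleHom ψ.toRingHom r d f) := by
  have hn : 0 < n := h ▸ Nat.mul_pos hd hm
  have hom (f : Laurent (K m) r) : rescaleHom ψ.toRingHom r d (πm (gn .om) f) =
      πn (gn .om) (rescaleHom ψ.toRingHom r d f) := by
    rw [hπm.eq_genOp hr hm, hπn.eq_genOp hr hn]
    exact rescaleHom_omOp h hψ.map_q f
  induction a using DAHA.induction generalizing f with
  | alg c =>
    rw [hφ.map_algebraMap hd, AlgHom.commutes, AlgHom.commutes, algebraMap_end, algebraMap_end,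
      LinearMap.smul_apply, LinearMap.smul_apply, Module.End.one_apply, Module.End.one_apply,
      rescaleHom_smul]
    congr 1
    exact hψ.map_algebraMap hd c
  | gens y =>
    cases y with
    | T j =>
      rw [hφ.map_T, hπm.eq_genOp hr hm, hπn.eq_genOp hr hn]
      refine rescaleHom_heckeOp hm hd h hψ.map_q (algHom_kIn ψ) (fun s => ?_) j f
      change ψ _ = _
      rw [coeffP, coeffP, map_mul, map_neg, algHom_kIn, hψ.map_g, mul_neg]
    | om => rw [hφ.map_om, hom]
    | omInv =>
      -- `IsPhi` prescribes nothing on ω⁻¹; its image is forced, and the intertwining follows by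
      -- writing f = ω(ω⁻¹ f).
      have h1 : φ (gn .omInv) = gn .omInv := by
        refine left_inv_eq_right_inv (a := gn .om) ?_ gn_om_mul_omInv
        rw [← hφ.map_om, ← map_mul, gn_omInv_mul_om, map_one]
      have h2 : f = πm (gn .om) (πm (gn .omInv) f) := by
        rw [← Module.End.mul_apply, ← map_mul, gn_om_mul_omInv, map_one, Module.End.one_apply]
      conv_rhs => rw [h2, hom, h1, ← Module.End.mul_apply, ← map_mul, gn_omInv_mul_om, map_one,
        Module.End.one_apply]
    | X l =>
      rw [hφ.map_X, hπm.eq_genOp hr hm, hπn.eq_genOp hr hn]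
      exact rescaleHom_mulX _ f
  | mul a b ha hb =>
    rw [map_mul, map_mul, map_mul, Module.End.mul_apply, Module.End.mul_apply, ha, hb]
  | add a b ha hb =>
    rw [map_add, map_add, map_add, LinearMap.add_apply, LinearMap.add_apply, map_add, ha, hb]

/-- An additive map that intertwines two representations, as a linear map. -/
def RepSpace.linearMap {A R R' V V' : Type} [Ring A] [Ring R] [Ring R'] [AddCommGroup V]
    [AddCommGroup V'] [Module R V] [Module R' V'] {ρ : A →+* Module.End R V}
    {ρ' : A →+* Module.End R' V'} (f : V →+ V') (hf : ∀ a v, f (ρ a v) = ρ' a (f v)) :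
    RepSpace ρ →ₗ[A] RepSpace ρ' where
  toFun := fun v => RepSpace.of ρ' (f ((RepSpace.of ρ).symm v))
  map_add' v w := by rw [map_add, map_add, map_add]
  map_smul' a v := hf a v

theorem RepSpace.exists_equiv_range {A R R' V V' : Type} [Ring A] [Ring R] [Ring R']
    [AddCommGroup V] [AddCommGroup V'] [Module R V] [Module R' V'] (ρ : A →+* Module.End R V)
    (ρ' : A →+* Module.End R' V') (f : V →+ V') (hf : ∀ a v, f (ρ a v) = ρ' a (f v))
    (inj : Function.Injective f) :
    ∃ N : Submodule A (RepSpace ρ'), (∀ w, RepSpace.of ρ' w ∈ N ↔ ∃ v, f v = w) ∧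
      ∃ e : RepSpace ρ ≃ₗ[A] N, ∀ v, (e (RepSpace.of ρ v) : RepSpace ρ') = RepSpace.of ρ' (f v) :=
  ⟨LinearMap.range (RepSpace.linearMap f hf), fun _ => Iff.rfl,
    LinearEquiv.ofInjective (RepSpace.linearMap f hf) inj, fun _ => rfl⟩

theorem RepSpace.exists_equiv_of_addEquiv {A R R' V V' M : Type} [Ring A] [Ring R] [Ring R']
    [AddCommGroup V] [AddCommGroup V'] [Module R V] [Module R' V'] [AddCommGroup M] [Module A M]
    {ρ : A →+* Module.End R V} (ρ' : A →+* Module.End R' V') (f : V ≃+ V')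
    (hf : ∀ a v, f (ρ a v) = ρ' a (f v)) (e : RepSpace ρ ≃ₗ[A] M) :
    ∃ e' : RepSpace ρ' ≃ₗ[A] M, ∀ v, e' (RepSpace.of ρ' (f v)) = e (RepSpace.of ρ v) := by
  let L := LinearEquiv.ofBijective (RepSpace.linearMap (ρ := ρ) (ρ' := ρ') f.toAddMonoidHom hf)
    f.bijective
  refine ⟨L.symm.trans e, fun v => ?_⟩
  have : L.symm (RepSpace.of ρ' (f v)) = RepSpace.of ρ v := L.symm_apply_eq.2 rfl
  rw [LinearEquiv.trans_apply, this]

theorem exists_rescale_equiv (hr : 2 ≤ r) (hm : 0 < m) (hd : 0 < d) (h : n = d * m)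
    {πm : DAHA r m →ₐ[F] Module.End (K m) (Laurent (K m) r)}
    {πn : DAHA r n →ₐ[F] Module.End (K n) (Laurent (K n) r)}
    {φ : DAHA r m →ₐ[Ck] DAHA r n} {ψ : K m →ₐ[Ck] K n}
    (hπm : IsMetaplecticBasicRep r m ε πm) (hπn : IsMetaplecticBasicRep r n ε πn)
    (hφ : IsPhi r d h φ) (hψ : IsJ d ε ψ) :
    ∃ N : Submodule (DAHA r m) (RepSpace (πn.toRingHom.comp φ.toRingHom)),
      (∀ f : Laurent (K n) r, RepSpace.of _ f ∈ N ↔ f ∈ subLaurent ψ.fieldRange r d) ∧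
      ∃ e : RepSpace πm.toRingHom ≃ₗ[DAHA r m] N,
        ∀ f : Laurent (K m) r,
          (e (RepSpace.of _ f) : RepSpace (πn.toRingHom.comp φ.toRingHom)) =
            RepSpace.of _ (rescale ψ.toRingHom d f) := by
  obtain ⟨N, hN, e, he⟩ := RepSpace.exists_equiv_range πm.toRingHom
    (πn.toRingHom.comp φ.toRingHom) (rescaleHom ψ.toRingHom r d).toAddMonoidHom
    (rescaleHom_intertwines hr hm hd h hπm hπn hφ hψ) (rescaleHom_injective ψ.toRingHom hd)
  refine ⟨N, fun f => (hN f).trans (range_rescaleHom ψ hd f), e, fun f => ?_⟩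
  rw [rescale_eq]
  exact he f

end Main

/-! ### Transport of Cherednik's basic representation -/

section Transport

variable {E E' : Type} [Field E] [Field E'] [Algebra Ck E] [Algebra Ck E'] {r : ℕ}

/-- The map on Laurent polynomials induced by an isomorphism of coefficient fields. -/
def mapLaurent (ψ : E ≃ₐ[Ck] E') (r : ℕ) : Laurent E r ≃+* Laurent E' r :=
  AddMonoidAlgebra.mapRingEquiv _ ψ.toRingEquiv

theorem mapLaurent_single (ψ : E ≃ₐ[Ck] E') (l : Lattice r) (c : E) :
    mapLaurent ψ r (AddMonoidAlgebra.single l c) = AddMonoidAlgebra.single l (ψ c) := by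
  simp [mapLaurent]

theorem mapLaurent_smul (ψ : E ≃ₐ[Ck] E') (c : E) (f : Laurent E r) :
    mapLaurent ψ r (c • f) = ψ c • mapLaurent ψ r f := by
  ext l
  simp [mapLaurent]

theorem mapLaurent_symm_smul (ψ : E ≃ₐ[Ck] E') (c : E') (f : Laurent E' r) :
    (mapLaurent ψ r).symm (c • f) = ψ.symm c • (mapLaurent ψ r).symm f := by
  rw [RingEquiv.symm_apply_eq, mapLaurent_smul, AlgEquiv.apply_symm_apply,
    RingEquiv.apply_symm_apply]

theorem mapLaurent_xmon (ψ : E ≃ₐ[Ck] E') (l : Lattice r) :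
    mapLaurent ψ r (xmon l) = xmon l := by
  rw [xmon, mapLaurent_single, map_one, xmon]

theorem mapLaurent_mon (ψ : E ≃ₐ[Ck] E') (q : E) (v : Lattice r × ℤ) :
    mapLaurent ψ r (mon q v) = mon (ψ q) v := by
  rw [mon, mapLaurent_single, map_zpow₀, mon]

/-- Transport of endomorphisms along an isomorphism of coefficient fields. -/
def conjEnd (ψ : E ≃ₐ[Ck] E') (r : ℕ) :
    Module.End E (Laurent E r) →+* Module.End E' (Laurent E' r) where
  toFun A :=
    { toFun := fun f => mapLaurent ψ r (A ((mapLaurent ψ r).symm f))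
      map_add' := fun f f' => by simp only [map_add]
      map_smul' := fun c f => by
        rw [mapLaurent_symm_smul, map_smul, mapLaurent_smul, AlgEquiv.apply_symm_apply,
          RingHom.id_apply] }
  map_one' := LinearMap.ext fun f => (mapLaurent ψ r).apply_symm_apply f
  map_mul' A B := LinearMap.ext fun f => by
    simp
  map_zero' := LinearMap.ext fun f => map_zero (mapLaurent ψ r)
  map_add' A B := LinearMap.ext fun f => map_add (mapLaurent ψ r) _ _

theorem conjEnd_apply (ψ : E ≃ₐ[Ck] E') (A : Module.End E (Laurent E r)) (f : Laurent E r) :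
    conjEnd ψ r A (mapLaurent ψ r f) = mapLaurent ψ r (A f) := by
  change mapLaurent ψ r (A ((mapLaurent ψ r).symm _)) = _
  rw [RingEquiv.symm_apply_apply]

theorem conjEnd_apply_xmon (ψ : E ≃ₐ[Ck] E') (A : Module.End E (Laurent E r)) (l : Lattice r) :
    conjEnd ψ r A (xmon l) = mapLaurent ψ r (A (xmon l)) := by
  rw [← conjEnd_apply, mapLaurent_xmon]

theorem conjEnd_algebraMap (ψ : E ≃ₐ[Ck] E') (c : E) :
    conjEnd ψ r (algebraMap E _ c) = algebraMap E' _ (ψ c) := by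
  refine LinearMap.ext fun f => ?_
  obtain ⟨f, rfl⟩ := (mapLaurent ψ r).surjective f
  rw [conjEnd_apply]
  exact mapLaurent_smul ψ c f

/-- The defining formulas involve only k, which ψ fixes, and q. Conjugation by ψ on coefficients
therefore gives the same representation with q replaced by ψ(q). -/
theorem IsCherednikBasicRep.transport (ψ : E ≃ₐ[Ck] E') {q : E}
    {ρ : DAHA r 1 →ₐ[Ck] Module.End E (Laurent E r)} (h : IsCherednikBasicRep r q ρ) :
    ∃ ρ' : DAHA r 1 →ₐ[Ck] Module.End E' (Laurent E' r), IsCherednikBasicRep r (ψ q) ρ' ∧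
      ∀ a f, mapLaurent ψ r (ρ a f) = ρ' a (mapLaurent ψ r f) := by
  have hc (c : Ck) : conjEnd ψ r (algebraMap Ck _ c) = algebraMap Ck _ c := by
    refine LinearMap.ext fun f => ?_
    obtain ⟨f, rfl⟩ := (mapLaurent ψ r).surjective f
    rw [conjEnd_apply]
    change mapLaurent ψ r (c • f) = c • mapLaurent ψ r f
    rw [← algebraMap_smul E, mapLaurent_smul, AlgEquiv.commutes, algebraMap_smul]
  refine ⟨{ (conjEnd ψ r).comp ρ.toRingHom with commutes' := fun c => ?_ }, ⟨?_, ?_, ?_, ?_⟩,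
    fun a f => (conjEnd_apply ψ _ f).symm⟩
  · exact (congrArg (conjEnd ψ r) (ρ.commutes c)).trans (hc c)
  · exact (congrArg (conjEnd ψ r) h.map_q).trans (conjEnd_algebraMap ψ q)
  · intro j l
    have := congrArg (mapLaurent ψ r) (h.map_T j l)
    rw [map_mul, map_add, mapLaurent_smul, mapLaurent_smul, map_mul, map_sub, map_sub, map_sub,
      map_one, mapLaurent_mon, mapLaurent_mon, mapLaurent_xmon, map_inv₀,
      show ψ (kIn E) = kIn E' from algHom_kIn ψ.toAlgHom, ← conjEnd_apply_xmon] at this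
    exact this
  · intro u l
    exact (conjEnd_apply_xmon ψ _ l).trans
      ((congrArg _ (h.map_X u l)).trans (mapLaurent_xmon ψ _))
  · intro l
    exact (conjEnd_apply_xmon ψ _ l).trans
      ((congrArg _ (h.map_om l)).trans (mapLaurent_mon ψ _ _))

theorem rescaleHom_mapLaurent {A : Type} [Field A] [Algebra Ck A] {E' : IntermediateField Ck A}
    (ψ : E ≃ₐ[Ck] E') (d : ℕ) (f : Laurent E r) :
    rescaleHom E'.val.toRingHom r d (mapLaurent ψ r f) =
      rescaleHom (E'.val.comp ψ.toAlgHom).toRingHom r d f := by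
  rw [← AddMonoidAlgebra.sum_coeff_single f, Finsupp.sum]
  simp only [map_sum, mapLaurent_single, rescaleHom_single]
  rfl

theorem IsCherednikBasicRep.realisesCherednik {A : Type} [Field A] [Algebra Ck A]
    {E' : IntermediateField Ck A} (ψ : E ≃ₐ[Ck] E') {q : E}
    {ρ : DAHA r 1 →ₐ[Ck] Module.End E (Laurent E r)} (h : IsCherednikBasicRep r q ρ) (d : ℕ)
    (σ : DAHA r 1 →+* Module.End A (Laurent A r)) (N : Submodule (DAHA r 1) (RepSpace σ))
    (e : RepSpace ρ.toRingHom ≃ₗ[DAHA r 1] N)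
    (he : ∀ f : Laurent E r, (e (RepSpace.of _ f) : RepSpace σ) =
      RepSpace.of _ (rescale (E'.val.comp ψ.toAlgHom).toRingHom d f)) :
    RealisesCherednik E' (ψ q : A) d σ N := by
  obtain ⟨ρ', hρ', hint⟩ := h.transport ψ
  obtain ⟨e', he'⟩ := RepSpace.exists_equiv_of_addEquiv ρ'.toRingHom
    (mapLaurent ψ r).toAddEquiv hint e
  refine ⟨ψ q, ρ', rfl, hρ', e', fun f => ?_⟩
  obtain ⟨f, rfl⟩ := (mapLaurent ψ r).surjective f
  refine (congrArg Subtype.val (he' f)).trans ((he f).trans ?_)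
  rw [rescale_eq, rescale_eq, rescaleHom_mapLaurent]

end Transport

theorem exists_realisesCherednik {r n : ℕ} {ε : ℤˣ} (hr : 2 ≤ r) (hn : 0 < n)
    {πn : DAHA r n →ₐ[F] Module.End (K n) (Laurent (K n) r)}
    {φ : DAHA r 1 →ₐ[Ck] DAHA r n} {ψ : K 1 →ₐ[Ck] K n}
    (hπn : IsMetaplecticBasicRep r n ε πn) (hφ : IsPhi r n (mul_one n).symm φ) (hψ : IsJ n ε ψ) :
    ∃ N : Submodule (DAHA r 1) (RepSpace (πn.toRingHom.comp φ.toRingHom)),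
      (∀ f : Laurent (K n) r, RepSpace.of _ f ∈ N ↔ f ∈ subLaurent ψ.fieldRange r n) ∧
      RealisesCherednik ψ.fieldRange (qIn (K n) ^ (n ^ 2)) n
        (πn.toRingHom.comp φ.toRingHom) N := by
  have hπ₁ := isMetaplecticBasicRep_metaplecticRep (n := 1) hr one_pos ε
  obtain ⟨N, hN, e, he⟩ := exists_rescale_equiv hr one_pos hn (mul_one n).symm hπ₁ hπn hφ hψ
  refine ⟨N, hN, ?_⟩
  -- Since q^{n²} = ψ(q), the parameter lies in the image field, and 𝕂⁽¹⁾ is identified with that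
  -- field by ψ.
  rw [← hψ.map_q]
  exact (hπ₁.isCherednikBasicRep hr).realisesCherednik (E' := ψ.fieldRange)
    (AlgEquiv.ofInjectiveField ψ) n _ N e he

end Metaplectic

end
open Metaplectic in
theorem mainTheorem8 (r : ℕ) (hr : 2 ≤ r) (ε : ℤˣ) (n : ℕ) (hn : 0 < n) :
    -- the general statement, for `m = n / κ'` with `κ'` a positive divisor of `n`
    (∀ (m κ' : ℕ) (h : n = κ' * m),
      -- all objects involved are well defined
      (∃! πm : DAHA r m →ₐ[F] Module.End (K m) (Laurent (K m) r),
        IsMetaplecticBasicRep r m ε πm) ∧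
      (∃! πn : DAHA r n →ₐ[F] Module.End (K n) (Laurent (K n) r),
        IsMetaplecticBasicRep r n ε πn) ∧
      (∃! φ : DAHA r m →ₐ[Ck] DAHA r n, IsPhi r κ' h φ) ∧
      (∃! ψ : K m →ₐ[Ck] K n, IsJ κ' ε ψ) ∧
      ∀ (πm : DAHA r m →ₐ[F] Module.End (K m) (Laurent (K m) r))
        (πn : DAHA r n →ₐ[F] Module.End (K n) (Laurent (K n) r))
        (φ : DAHA r m →ₐ[Ck] DAHA r n) (ψ : K m →ₐ[Ck] K n),
        IsMetaplecticBasicRep r m ε πm → IsMetaplecticBasicRep r n ε πn →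
        IsPhi r κ' h φ → IsJ κ' ε ψ →
        ∃ N : Submodule (DAHA r m) (RepSpace (πn.toRingHom.comp φ.toRingHom)),
          (∀ f : Laurent (K n) r,
            RepSpace.of _ f ∈ N ↔ f ∈ subLaurent ψ.fieldRange r κ') ∧
          ∃ e : RepSpace πm.toRingHom ≃ₗ[DAHA r m] N,
            ∀ f : Laurent (K m) r,
              (e (RepSpace.of _ f) : RepSpace (πn.toRingHom.comp φ.toRingHom)) =
                RepSpace.of _ (rescale ψ.toRingHom κ' f)) ∧
    -- the representation for `m = 1` is Cherednik's basic representation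
    (∀ π₁ : DAHA r 1 →ₐ[F] Module.End (K 1) (Laurent (K 1) r),
      IsMetaplecticBasicRep r 1 ε π₁ →
        IsCherednikBasicRep r (qIn (K 1)) (π₁.restrictScalars Ck)) ∧
    -- the special case `κ' = n`, `m = 1`
    (∀ (πn : DAHA r n →ₐ[F] Module.End (K n) (Laurent (K n) r))
      (φ : DAHA r 1 →ₐ[Ck] DAHA r n) (ψ : K 1 →ₐ[Ck] K n),
      IsMetaplecticBasicRep r n ε πn → IsPhi r n (mul_one n).symm φ → IsJ n ε ψ →
      ∃ N : Submodule (DAHA r 1) (RepSpace (πn.toRingHom.comp φ.toRingHom)),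
        (∀ f : Laurent (K n) r,
          RepSpace.of _ f ∈ N ↔ f ∈ subLaurent ψ.fieldRange r n) ∧
        RealisesCherednik ψ.fieldRange (qIn (K n) ^ (n ^ 2)) n
          (πn.toRingHom.comp φ.toRingHom) N) := by
  refine ⟨fun m κ' h => ?_, fun π₁ h => h.isCherednikBasicRep hr, fun πn φ ψ h1 h2 h3 =>
    exists_realisesCherednik hr hn h1 h2 h3⟩
  have hd : 0 < κ' := Nat.pos_of_ne_zero fun h0 => by simp [h0] at h; omega
  have hm : 0 < m := Nat.pos_of_ne_zero fun h0 => by simp [h0] at h; omega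
  exact ⟨existsUnique_metaplecticRep hr hm ε, existsUnique_metaplecticRep hr hn ε,
    existsUnique_phi h hd, existsUnique_j hm h hd ε,
    fun πm πn φ ψ h1 h2 h3 h4 => exists_rescale_equiv hr hm hd h h1 h2 h3 h4⟩
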